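/- For $\varepsilon>0$ and $\gamma>0$ let $\mathcal{E}$ be the space of all $\Psi=(\psi_1,\psi_2)\in H^1(\mathbb{R};\mathbb{R}^2)$ with $|x|\Psi\in L^2(\mathbb{R};\mathbb{R}^2)$, with the norm $\|\Psi\|_{\mathcal{E}}^2=\int_{\mathbb{R}}\big[(\psi_1')^2+(\psi_2')^2+(1+x^2)(\psi_1^2+\psi_2^2)\big]\,dx$, and let $$G_\varepsilon(\Psi)=\frac12\int_{\mathbb{R}}\Big[\varepsilon^2(\psi_1')^2+\varepsilon^2(\psi_2')^2+(x^2-1)(\psi_1^2+\psi_2^2)+\tfrac12(\psi_1^2+\psi_2^2)^2+(\gamma-1)\psi_1^2\psi_2^2\Big]\,dx,\qquad \Psi\in\mathcal{E}.$$ Its Euler--Lagrange equations are $$-\varepsilon^2\psi_1''+x^2\psi_1+(\psi_1^2+\gamma\psi_2^2-1)\psi_1=0,\qquad -\varepsilon^2\psi_2''+x^2\psi_2+(\gamma\psi_1^2+\psi_2^2-1)\psi_2=0,\qquad x\in\mathbb{R}. \tag{1}$$ A saddle point of $G_\varepsilon$ is a critical point of $G_\varepsilon$ in $\mathcal{E}$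 such that each of its neighbourhoods in $\mathcal{E}$ contains points of strictly smaller and points of strictly larger energy. **Theorem.** Let $\varepsilon>0$ and let $\eta_\varepsilon\in H^1(\mathbb{R})$ with $|x|\eta_\varepsilon\in L^2(\mathbb{R})$ be a positive classical solution of $$\varepsilon^2\eta_\varepsilon''+(1-x^2-\eta_\varepsilon^2)\eta_\varepsilon=0\quad\text{on }\mathbb{R}.$$ 1. If $0<\gamma<1$, the symmetric state $(1+\gamma)^{-1/2}(\eta_\varepsilon,\eta_\varepsilon)$ is a global minimizer of $G_\varepsilon$ in $\mathcal{E}$, and it is the only classical solution of (1) on $\mathbb{R}$ with both components positive. The uncoupled states $(\eta_\varepsilon,0)$ and $(0,\eta_\varepsilon)$ are saddle points of $G_\varepsilon$. 2. If $\gamma>1$, the symmetric state is a saddle point of $G_\varepsilon$, and the uncoupled states are, up to sign, the only global minimizers of $G_\varepsilon$ in $\mathcal{E}$: the set of global minimizers is $\{(\eta_\varepsilon,0),(-\eta_\varepsilon,0),(0,\eta_\varepsilon),(0,-\eta_\varepsilon)\}$. -/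

import Mathlib

open MeasureTheory
open scoped ContDiff

namespace GrossPitaevskii

/-- `g` is the weak derivative of `f` on the real line: both are locally integrable, and
`∫ f φ' = - ∫ g φ` for every smooth compactly supported test function `φ`. -/
def HasWeakDeriv (f g : ℝ → ℝ) : Prop :=
  LocallyIntegrable f volume ∧ LocallyIntegrable g volume ∧
    ∀ φ : ℝ → ℝ, ContDiff ℝ ∞ φ → HasCompactSupport φ →
      ∫ x, f x * deriv φ x = - ∫ x, g x * φ x

/-- Weak derivatives are unique up to null sets. -/
theorem HasWeakDeriv.ae_eq {f g h : ℝ → ℝ} (hg : HasWeakDeriv f g) (hh : HasWeakDeriv f h) :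
    g =ᵐ[volume] h := by
  have key : ∀ᵐ x ∂(volume : Measure ℝ), (g - h) x = 0 := by
    refine ae_eq_zero_of_integral_contDiff_smul_eq_zero (hg.2.1.sub hh.2.1) ?_
    intro φ hφ hc
    have h1 := hg.2.2 φ hφ hc
    have h2 := hh.2.2 φ hφ hc
    have i1 : Integrable (fun x => φ x • g x) volume :=
      hg.2.1.integrable_smul_left_of_hasCompactSupport hφ.continuous hc
    have i2 : Integrable (fun x => φ x • h x) volume :=
      hh.2.1.integrable_smul_left_of_hasCompactSupport hφ.continuous hc
    have e : (fun x => φ x • (g - h) x) = fun x => φ x • g x - φ x • h x := by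
      funext x
      simp [mul_sub]
    rw [e, integral_sub i1 i2]
    have e1 : ∫ x, φ x • g x = ∫ x, g x * φ x := by simp [mul_comm]
    have e2 : ∫ x, φ x • h x = ∫ x, h x * φ x := by simp [mul_comm]
    rw [e1, e2]
    linarith
  filter_upwards [key] with x hx
  simpa [sub_eq_zero] using hx

open Classical in
/-- The weak derivative of `f` (a representative of it), and `0` if `f` has none. -/
noncomputable def weakDeriv (f : ℝ → ℝ) : ℝ → ℝ :=
  if h : ∃ g, HasWeakDeriv f g then h.choose else 0

theorem HasWeakDeriv.weakDeriv_ae_eq {f g : ℝ → ℝ} (hg : HasWeakDeriv f g) :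
    weakDeriv f =ᵐ[volume] g := by
  have h : ∃ g, HasWeakDeriv f g := ⟨g, hg⟩
  have e : weakDeriv f = h.choose := by
    unfold weakDeriv
    exact dif_pos h
  rw [e]
  exact h.choose_spec.ae_eq hg

/-- `f` belongs to `H¹(ℝ) ∩ L^{2,1}(ℝ)`: `f`, `|x| f` and the weak derivative of `f` are
square integrable. Functions in this space matter only up to null sets. -/
structure MemScalarEnergySpace (f : ℝ → ℝ) : Prop where
  memLp : MemLp f 2 volume
  memLp_weight : MemLp (fun x => |x| * f x) 2 volume
  exists_weakDeriv : ∃ g, HasWeakDeriv f g ∧ MemLp g 2 volume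

/-- The energy space `𝓔 = H¹(ℝ; ℝ²) ∩ L^{2,1}(ℝ; ℝ²)`. -/
def energySpace : Set ((ℝ → ℝ) × (ℝ → ℝ)) :=
  {Ψ | MemScalarEnergySpace Ψ.1 ∧ MemScalarEnergySpace Ψ.2}

/-- The norm of the energy space,
`‖Ψ‖² = ∫ (ψ₁')² + (ψ₂')² + (1 + x²) (ψ₁² + ψ₂²)`. -/
noncomputable def energyNorm (Ψ : (ℝ → ℝ) × (ℝ → ℝ)) : ℝ :=
  √(∫ x, (weakDeriv Ψ.1 x ^ 2 + weakDeriv Ψ.2 x ^ 2 + (1 + x ^ 2) * (Ψ.1 x ^ 2 + Ψ.2 x ^ 2)))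

/-- The Gross--Pitaevskii energy `G_ε` with coupling parameter `γ`. -/
noncomputable def energy (ε γ : ℝ) (Ψ : (ℝ → ℝ) × (ℝ → ℝ)) : ℝ :=
  (1 / 2) * ∫ x, (ε ^ 2 * weakDeriv Ψ.1 x ^ 2 + ε ^ 2 * weakDeriv Ψ.2 x ^ 2
    + (x ^ 2 - 1) * (Ψ.1 x ^ 2 + Ψ.2 x ^ 2)
    + (1 / 2) * (Ψ.1 x ^ 2 + Ψ.2 x ^ 2) ^ 2
    + (γ - 1) * (Ψ.1 x ^ 2 * Ψ.2 x ^ 2))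

/-- `Ψ` is a global minimizer of `G_ε` in the energy space. -/
def IsGlobalMinimizer (ε γ : ℝ) (Ψ : (ℝ → ℝ) × (ℝ → ℝ)) : Prop :=
  Ψ ∈ energySpace ∧ ∀ Υ ∈ energySpace, energy ε γ Ψ ≤ energy ε γ Υ

/-- `Ψ` is a critical point of `G_ε` in the energy space: the first variation at `Ψ` vanishes
in every direction of the energy space. -/
def IsCriticalPoint (ε γ : ℝ) (Ψ : (ℝ → ℝ) × (ℝ → ℝ)) : Prop :=
  Ψ ∈ energySpace ∧
    ∀ V ∈ energySpace, HasDerivAt (fun t : ℝ => energy ε γ (Ψ + t • V)) 0 0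

/-- `Ψ` is a saddle point of `G_ε` in the energy space: a critical point such that every
neighbourhood of it contains points of strictly smaller and of strictly larger energy. -/
def IsSaddlePoint (ε γ : ℝ) (Ψ : (ℝ → ℝ) × (ℝ → ℝ)) : Prop :=
  IsCriticalPoint ε γ Ψ ∧ ∀ δ > 0,
    (∃ Υ ∈ energySpace, energyNorm (Υ - Ψ) < δ ∧ energy ε γ Υ < energy ε γ Ψ) ∧
    (∃ Υ ∈ energySpace, energyNorm (Υ - Ψ) < δ ∧ energy ε γ Ψ < energy ε γ Υ)

/-- `η` is the ground state `η_ε` of the scalar equation: a positive classical solution in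
`H¹(ℝ) ∩ L^{2,1}(ℝ)` of `ε² η'' + (1 - x² - η²) η = 0` on the real line. -/
structure IsGroundState (ε : ℝ) (η : ℝ → ℝ) : Prop where
  contDiff : ContDiff ℝ 2 η
  mem : MemScalarEnergySpace η
  pos : ∀ x, 0 < η x
  eqn : ∀ x, ε ^ 2 * deriv (deriv η) x + (1 - x ^ 2 - η x ^ 2) * η x = 0

/-- `Ψ = (ψ₁, ψ₂)` is a classical solution on the real line, with both components positive, of
the coupled Gross--Pitaevskii system. -/
structure IsPositiveSolution (ε γ : ℝ) (Ψ : (ℝ → ℝ) × (ℝ → ℝ)) : Prop where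
  contDiff_fst : ContDiff ℝ 2 Ψ.1
  contDiff_snd : ContDiff ℝ 2 Ψ.2
  pos_fst : ∀ x, 0 < Ψ.1 x
  pos_snd : ∀ x, 0 < Ψ.2 x
  eqn_fst : ∀ x, -ε ^ 2 * deriv (deriv Ψ.1) x + x ^ 2 * Ψ.1 x
    + (Ψ.1 x ^ 2 + γ * Ψ.2 x ^ 2 - 1) * Ψ.1 x = 0
  eqn_snd : ∀ x, -ε ^ 2 * deriv (deriv Ψ.2) x + x ^ 2 * Ψ.2 x
    + (γ * Ψ.1 x ^ 2 + Ψ.2 x ^ 2 - 1) * Ψ.2 x = 0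

/-- The symmetric state `ψ₁ = ψ₂ = (1 + γ)^{-1/2} η`. -/
noncomputable def symmetricState (γ : ℝ) (η : ℝ → ℝ) : (ℝ → ℝ) × (ℝ → ℝ) :=
  (fun x => (√(1 + γ))⁻¹ * η x, fun x => (√(1 + γ))⁻¹ * η x)

/-- The uncoupled state `(η, 0)`. -/
def uncoupledFst (η : ℝ → ℝ) : (ℝ → ℝ) × (ℝ → ℝ) := (η, 0)

/-- The uncoupled state `(0, η)`. -/
def uncoupledSnd (η : ℝ → ℝ) : (ℝ → ℝ) × (ℝ → ℝ) := (0, η)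

/-- Equality in the energy space: both components agree almost everywhere. -/
def AEEq (Ψ Υ : (ℝ → ℝ) × (ℝ → ℝ)) : Prop :=
  Ψ.1 =ᵐ[volume] Υ.1 ∧ Ψ.2 =ᵐ[volume] Υ.2

end GrossPitaevskii

namespace GrossPitaevskii

open Filter Set Topology

/-! Let Q be the quadratic form `scalarForm ε η`, and p = η'/η. Since η is a positive zero mode of
the associated Schrödinger operator, the Jacobi substitution gives Q(f) = ε² ∫ (f' − p f)²
(`scalarForm_eq`). Hence Q ≥ 0, with equality only for multiples of η. Adding and subtracting η²(ψ₁²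
+ ψ₂²) writes 2G_ε as Q(ψ₁) + Q(ψ₂) plus the integral of a pointwise quartic (`energy_eq`).
Completing squares bounds that quartic below by a multiple of η⁴, attained by the symmetric state
for γ < 1 and by the uncoupled states for γ > 1. In the latter case equality forces both components
to be multiples of η, and the minimizers are found by algebra in the two coefficients.

On the plane of pairs (aη, bη) the energy is a positive multiple of the polynomial `reducedEnergy`.
Its critical points give critical points of G_ε in the whole space, and points of lower and higher
energy near a saddle are already found in this plane (`isSaddlePoint_smul`).

For uniqueness, a positive solution (u, v) is compared with the symmetric state (w, w) by a
Brezis-Oswald function B. With s = u² − w² and t = v² − w², its derivative is a sum of squares plus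
(s² + 2γst + t²)/ε², which is positive definite for 0 < γ < 1. As B is monotone with limit 0 at both
ends, it vanishes and s = t = 0. No integrability of (u, v) is assumed, so the limits rest on a
priori estimates: an increasing positive solution would blow up at a finite point, so solutions
decay exponentially, and their logarithmic derivatives grow at most linearly. The same bound on p
justifies the Jacobi identity on the whole energy space. -/

/-! ### Primitives of locally integrable functions -/

/-- `F` is a primitive of the locally integrable function `g`. -/
def IsPrimitive (F g : ℝ → ℝ) : Prop :=
  LocallyIntegrable g volume ∧ ∀ a b, ∫ x in a..b, g x = F b - F a

theorem LocallyIntegrable.intervalIntegrable_real {g : ℝ → ℝ} (hg : LocallyIntegrable g volume)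
    (a b : ℝ) : IntervalIntegrable g volume a b :=
  intervalIntegrable_iff.mpr
    ((hg.integrableOn_isCompact isCompact_uIcc).mono_set uIoc_subset_uIcc)

namespace IsPrimitive

variable {F G f g : ℝ → ℝ}

theorem eq_add (h : IsPrimitive F f) (a : ℝ) : F = fun x => F a + ∫ t in a..x, f t := by
  funext x
  rw [h.2 a x]; ring

theorem ae_hasDerivAt (h : IsPrimitive F f) : ∀ᵐ x, HasDerivAt F (f x) x := by
  filter_upwards [LocallyIntegrable.ae_hasDerivAt_integral h.1] with x hx
  rw [h.eq_add 0]
  exact (hx 0).const_add _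

theorem absolutelyContinuous (h : IsPrimitive F f) (a b : ℝ) :
    AbsolutelyContinuousOnInterval F a b := by
  have h1 := (LocallyIntegrable.intervalIntegrable_real h.1 a
    b).absolutelyContinuousOnInterval_intervalIntegral (c := a) (by simp)
  have h2 : AbsolutelyContinuousOnInterval (fun _ : ℝ => F a) a b :=
    (contDiff_const.contDiffOn (n := 1)).absolutelyContinuousOnInterval
  rw [h.eq_add a]
  exact h2.add h1

theorem continuous (h : IsPrimitive F f) : Continuous F := by
  rw [h.eq_add 0]
  exact continuous_const.add (intervalIntegral.continuous_primitive
    (LocallyIntegrable.intervalIntegrable_real h.1) 0)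

theorem mul (hF : IsPrimitive F f) (hG : IsPrimitive G g) :
    IsPrimitive (fun x => F x * G x) (fun x => f x * G x + F x * g x) := by
  refine ⟨?_, fun a b => ?_⟩
  · have key : ∀ {u v : ℝ → ℝ}, LocallyIntegrable u volume → Continuous v →
        LocallyIntegrable (fun x => v x • u x) volume := fun hu hv =>
      locallyIntegrableOn_univ.1 (LocallyIntegrableOn.continuousOn_smul
        isOpen_univ.isLocallyClosed (locallyIntegrableOn_univ.2 hu) hv.continuousOn)
    refine ((key hF.1 hG.continuous).add (key hG.1 hF.continuous)).congr
      (Eventually.of_forall fun x => ?_)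
    simp [mul_comm]
  · rw [← (hF.absolutelyContinuous a b).integral_deriv_mul_eq_sub (hG.absolutelyContinuous a b)]
    apply intervalIntegral.integral_congr_ae
    filter_upwards [hF.ae_hasDerivAt, hG.ae_hasDerivAt] with x h1 h2 _
    rw [h1.deriv, h2.deriv]

theorem of_contDiff (hF : ContDiff ℝ 1 F) : IsPrimitive F (deriv F) := by
  have hc : Continuous (deriv F) := hF.continuous_deriv le_rfl
  refine ⟨hc.locallyIntegrable, fun a b => ?_⟩
  exact intervalIntegral.integral_deriv_eq_sub
    (fun x _ => (hF.differentiable one_ne_zero).differentiableAt) (hc.intervalIntegrable a b)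

/-- Integrability of f gives F limits at both ends, and integrability of F forces these limits to be
0. This removes the boundary terms in later integrations by parts. -/
theorem integral_eq_zero (h : IsPrimitive F f) (hf : Integrable f) (hF : Integrable F) :
    ∫ x, f x = 0 := by
  have top : Tendsto F atTop (𝓝 0) := by
    have h1 : Tendsto (fun x => F 0 + ∫ t in (0 : ℝ)..x, f t) atTop
        (𝓝 (F 0 + ∫ t in Ioi (0 : ℝ), f t)) :=
      (intervalIntegral_tendsto_integral_Ioi 0 hf.integrableOn tendsto_id).const_add _
    rw [← h.eq_add 0] at h1
    have h2 := IntegrableAtFilter.eq_zero_of_tendsto (hF.integrableAtFilter atTop) (fun s hs => by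
      rcases mem_atTop_sets.1 hs with ⟨b, hb⟩
      rw [← top_le_iff, ← Real.volume_Ici (a := b)]
      exact measure_mono hb) h1
    rwa [h2] at h1
  have bot : Tendsto F atBot (𝓝 0) := by
    have h1 : Tendsto (fun x => F 0 - ∫ t in x..(0 : ℝ), f t) atBot
        (𝓝 (F 0 - ∫ t in Iic (0 : ℝ), f t)) :=
      (intervalIntegral_tendsto_integral_Iic 0 hf.integrableOn tendsto_id).const_sub _
    have h0 : F = (fun x => F 0 - ∫ t in x..(0 : ℝ), f t) := by
      funext x
      rw [h.2 x 0]; ring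
    rw [← h0] at h1
    have h2 := IntegrableAtFilter.eq_zero_of_tendsto (hF.integrableAtFilter atBot) (fun s hs => by
      rcases mem_atBot_sets.1 hs with ⟨b, hb⟩
      rw [← top_le_iff, ← Real.volume_Iic (a := b)]
      exact measure_mono hb) h1
    rwa [h2] at h1
  have h3 := intervalIntegral_tendsto_integral hf tendsto_neg_atTop_atBot tendsto_id
  have h4 : Tendsto (fun x : ℝ => F x - F (-x)) atTop (𝓝 (0 - 0)) :=
    top.sub (bot.comp tendsto_neg_atTop_atBot)
  rw [sub_zero] at h4
  refine tendsto_nhds_unique h3 (h4.congr fun x => ?_)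
  rw [id, h.2]

theorem hasWeakDeriv (h : IsPrimitive F f) : HasWeakDeriv F f := by
  refine ⟨h.continuous.locallyIntegrable, h.1, fun φ hφ hc => ?_⟩
  have h1 := h.mul (of_contDiff (hφ.of_le (by exact_mod_cast le_top)))
  have hd : Continuous (deriv φ) := hφ.continuous_deriv (by exact_mod_cast le_top)
  have i1 : Integrable (fun x => f x * φ x) :=
    h.1.integrable_smul_right_of_hasCompactSupport hφ.continuous hc
  have i2 : Integrable (fun x => F x * deriv φ x) :=
    h.continuous.locallyIntegrable.integrable_smul_right_of_hasCompactSupport hd hc.deriv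
  have i3 : Integrable (fun x => F x * φ x) :=
    h.continuous.locallyIntegrable.integrable_smul_right_of_hasCompactSupport hφ.continuous hc
  have h2 := h1.integral_eq_zero (i1.add i2) i3
  rw [integral_add i1 i2] at h2
  linarith

/-- One-dimensional Sobolev embedding: compare F x with F y for y in [x, x + 1] through |f| ≤ 1 +
f², then average over y. -/
theorem exists_bound (h : IsPrimitive F f) (hF : MemLp F 2 volume) (hf : MemLp f 2 volume) :
    ∃ M, ∀ x, |F x| ≤ M := by
  have iF := hF.integrable_sq
  have i_f := hf.integrable_sq
  refine ⟨2 + (∫ x, F x ^ 2) + ∫ x, f x ^ 2, fun x => ?_⟩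
  have e1 : ∀ y ∈ Icc x (x + 1), |F x| ≤ |F y| + (1 + ∫ t, f t ^ 2) := by
    intro y hy
    have h1 : |F y - F x| ≤ ∫ t in x..y, |f t| := by
      rw [← h.2 x y]
      exact intervalIntegral.abs_integral_le_integral_abs hy.1
    have h2 : ∫ t in x..y, |f t| ≤ ∫ t in x..y, (1 + f t ^ 2) := by
      apply intervalIntegral.integral_mono_on hy.1
      · exact (LocallyIntegrable.intervalIntegrable_real h.1 _ _).abs
      · exact intervalIntegrable_const.add i_f.intervalIntegrable
      · intro t _
        nlinarith [sq_nonneg (|f t| - 1), sq_abs (f t), abs_nonneg (f t)]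
    have h3 : ∫ t in x..y, (1 + f t ^ 2) = (y - x) + ∫ t in x..y, f t ^ 2 := by
      rw [intervalIntegral.integral_add intervalIntegrable_const i_f.intervalIntegrable]
      simp
    have h4 : ∫ t in x..y, f t ^ 2 ≤ ∫ t, f t ^ 2 := by
      rw [intervalIntegral.integral_of_le hy.1]
      exact setIntegral_le_integral i_f (Eventually.of_forall fun t => sq_nonneg _)
    have h5 : |F x| ≤ |F y| + |F y - F x| := by
      have := abs_sub_abs_le_abs_sub (F x) (F y)
      rw [abs_sub_comm] at this
      linarith
    linarith [hy.2]
  have e2 : ∫ y in x..(x + 1), |F x| ≤ ∫ y in x..(x + 1), (1 + F y ^ 2 + (1 + ∫ t, f t ^ 2)) := by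
    apply intervalIntegral.integral_mono_on (by linarith) intervalIntegrable_const
    · exact (intervalIntegrable_const.add iF.intervalIntegrable).add intervalIntegrable_const
    · intro y hy
      have := e1 y hy
      nlinarith [sq_nonneg (|F y| - 1), sq_abs (F y), abs_nonneg (F y)]
  have e3 : ∫ y in x..(x + 1), F y ^ 2 ≤ ∫ y, F y ^ 2 := by
    rw [intervalIntegral.integral_of_le (by linarith)]
    exact setIntegral_le_integral iF (Eventually.of_forall fun t => sq_nonneg _)
  rw [intervalIntegral.integral_add (intervalIntegrable_const.add iF.intervalIntegrable)
    intervalIntegrable_const, intervalIntegral.integral_add intervalIntegrable_const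
    iF.intervalIntegrable] at e2
  simp only [intervalIntegral.integral_const, add_sub_cancel_left, smul_eq_mul, one_mul] at e2
  linarith

end IsPrimitive

/-! ### Weak derivatives and primitives (du Bois-Reymond) -/

theorem exists_contDiff_hasCompactSupport_deriv_eq {φ : ℝ → ℝ} (hφ : ContDiff ℝ ∞ φ)
    (hc : HasCompactSupport φ) (h0 : ∫ x, φ x = 0) :
    ∃ Φ : ℝ → ℝ, ContDiff ℝ ∞ Φ ∧ HasCompactSupport Φ ∧ deriv Φ = φ := by
  obtain ⟨R, hR⟩ := hc.isCompact.isBounded.subset_closedBall 0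
  have hz : ∀ x, R < |x| → φ x = 0 := fun x hx => by
    by_contra hne
    have := hR (subset_tsupport φ hne)
    rw [Metric.mem_closedBall, dist_zero_right, Real.norm_eq_abs] at this
    linarith
  have hd : ∀ x, HasDerivAt (fun x => ∫ t in Iic x, φ t) (φ x) x := fun x => by
    have hi := hφ.continuous.integrable_of_hasCompactSupport hc (μ := volume)
    have e : (fun x => ∫ t in Iic x, φ t) =
        fun x => (∫ t in Iic 0, φ t) + ∫ t in (0 : ℝ)..x, φ t := by
      funext y
      rw [← intervalIntegral.integral_Iic_sub_Iic hi.integrableOn hi.integrableOn]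
      ring
    rw [e]
    exact (intervalIntegral.integral_hasDerivAt_right (hφ.continuous.intervalIntegrable _ _)
      hφ.continuous.stronglyMeasurable.stronglyMeasurableAtFilter
      hφ.continuous.continuousAt).const_add _
  have hderiv : deriv (fun x => ∫ t in Iic x, φ t) = φ := funext fun x => (hd x).deriv
  refine ⟨fun x => ∫ t in Iic x, φ t, ?_, ?_, hderiv⟩
  · rw [contDiff_infty_iff_deriv]
    refine ⟨fun x => (hd x).differentiableAt, ?_⟩
    rw [hderiv]
    exact hφ
  · refine HasCompactSupport.intro (isCompact_closedBall (0 : ℝ) R) fun x hx => ?_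
    rw [Metric.mem_closedBall, dist_zero_right, Real.norm_eq_abs, not_le] at hx
    rcases lt_abs.1 hx with h | h
    · have hi := hφ.continuous.integrable_of_hasCompactSupport hc (μ := volume)
      rw [← intervalIntegral.integral_Iic_add_Ioi (b := x) hi.integrableOn hi.integrableOn] at h0
      rw [setIntegral_eq_zero_of_forall_eq_zero (t := Ioi x)
        fun t ht => hz t (lt_abs.2 (Or.inl (h.trans ht)))] at h0
      simpa using h0
    · exact setIntegral_eq_zero_of_forall_eq_zero fun t ht =>
        hz t (lt_abs.2 (Or.inr (by rw [mem_Iic] at ht; linarith)))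

/-- For a bump χ of integral 1, the function ψ − (∫ψ)χ has mean zero, hence is the derivative of a
test function. Testing with it identifies f with the constant ∫ fχ. -/
theorem HasWeakDeriv.ae_eq_const {f : ℝ → ℝ} (h : HasWeakDeriv f 0) :
    ∃ c : ℝ, f =ᵐ[volume] fun _ => c := by
  let b : ContDiffBump (0 : ℝ) := ⟨1, 2, one_pos, one_lt_two⟩
  let χ : ℝ → ℝ := b.normed volume
  have hχ : ContDiff ℝ ∞ χ := b.contDiff_normed
  have hχc : HasCompactSupport χ := b.hasCompactSupport_normed
  have hχ1 : ∫ x, χ x = 1 := b.integral_normed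
  have ifm : ∀ ψ : ℝ → ℝ, Continuous ψ → HasCompactSupport ψ → Integrable fun x => f x * ψ x :=
    fun ψ h1 h2 => h.1.integrable_smul_right_of_hasCompactSupport h1 h2
  refine ⟨∫ x, f x * χ x, ?_⟩
  set c := ∫ x, f x * χ x with hcdef
  have key : ∀ᵐ x ∂(volume : Measure ℝ), (fun x => f x - c) x = 0 := by
    refine ae_eq_zero_of_integral_contDiff_smul_eq_zero
      (h.1.sub (locallyIntegrable_const c)) fun ψ hψ hψc => ?_
    have iψ : Integrable ψ := hψ.continuous.integrable_of_hasCompactSupport hψc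
    have iχ : Integrable χ := hχ.continuous.integrable_of_hasCompactSupport hχc
    have hm : HasCompactSupport fun x => (∫ y, ψ y) * χ x := hχc.mul_left
    obtain ⟨Φ, h1, h2, h3⟩ := exists_contDiff_hasCompactSupport_deriv_eq
      (φ := fun x => ψ x - (∫ y, ψ y) * χ x) (hψ.sub (contDiff_const.mul hχ))
      (hψc.sub hm) (by
        rw [integral_sub iψ (iχ.const_mul _), integral_const_mul, hχ1]; ring)
    have h4 := h.2.2 Φ h1 h2
    rw [h3] at h4
    have e1 : (fun x => f x * (ψ x - (∫ y, ψ y) * χ x)) =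
        fun x => f x * ψ x - (∫ y, ψ y) * (f x * χ x) := by funext x; ring
    rw [e1, integral_sub (ifm _ hψ.continuous hψc)
      ((ifm _ hχ.continuous hχc).const_mul _), integral_const_mul] at h4
    have e2 : (fun x => ψ x • (fun x => f x - c) x) = fun x => f x * ψ x - c * ψ x := by
      funext x; simp only [smul_eq_mul]; ring
    rw [e2, integral_sub (ifm _ hψ.continuous hψc) (iψ.const_mul _), integral_const_mul]
    simp only [Pi.zero_apply, zero_mul, integral_zero, neg_zero] at h4
    rw [← hcdef] at h4
    linarith
  filter_upwards [key] with x hx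
  simpa [sub_eq_zero] using hx

theorem HasWeakDeriv.add {f g f' g' : ℝ → ℝ} (hf : HasWeakDeriv f f') (hg : HasWeakDeriv g g') :
    HasWeakDeriv (f + g) (f' + g') := by
  refine ⟨hf.1.add hg.1, hf.2.1.add hg.2.1, fun φ hφ hc => ?_⟩
  have hd : Continuous (deriv φ) := hφ.continuous_deriv (by exact_mod_cast le_top)
  have i : ∀ {u ψ : ℝ → ℝ}, LocallyIntegrable u volume → Continuous ψ → HasCompactSupport ψ →
      Integrable fun x => u x * ψ x :=
    fun hu h1 h2 => hu.integrable_smul_right_of_hasCompactSupport h1 h2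
  simp only [Pi.add_apply, add_mul]
  rw [integral_add (i hf.1 hd hc.deriv) (i hg.1 hd hc.deriv),
    integral_add (i hf.2.1 hφ.continuous hc) (i hg.2.1 hφ.continuous hc),
    hf.2.2 φ hφ hc, hg.2.2 φ hφ hc]
  ring

theorem HasWeakDeriv.const_smul {f f' : ℝ → ℝ} (hf : HasWeakDeriv f f') (c : ℝ) :
    HasWeakDeriv (c • f) (c • f') := by
  refine ⟨hf.1.smul c, hf.2.1.smul c, fun φ hφ hc => ?_⟩
  simp only [Pi.smul_apply, smul_eq_mul, mul_assoc]
  rw [integral_const_mul, integral_const_mul, hf.2.2 φ hφ hc]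
  ring

theorem HasWeakDeriv.congr {f g f' : ℝ → ℝ} (hf : HasWeakDeriv f f') (h : f =ᵐ[volume] g) :
    HasWeakDeriv g f' := by
  refine ⟨hf.1.congr h, hf.2.1, fun φ hφ hc => ?_⟩
  rw [← hf.2.2 φ hφ hc]
  refine integral_congr_ae ?_
  filter_upwards [h] with x hx
  rw [hx]

theorem HasWeakDeriv.exists_isPrimitive {f g : ℝ → ℝ} (h : HasWeakDeriv f g) :
    ∃ F, IsPrimitive F g ∧ f =ᵐ[volume] F := by
  have hP : IsPrimitive (fun x => ∫ t in (0 : ℝ)..x, g t) g := by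
    refine ⟨h.2.1, fun a b => ?_⟩
    rw [intervalIntegral.integral_interval_sub_left] <;>
      exact LocallyIntegrable.intervalIntegrable_real h.2.1 _ _
  have h1 := h.add (hP.hasWeakDeriv.const_smul (-1))
  rw [neg_one_smul, neg_one_smul, add_neg_cancel] at h1
  obtain ⟨c, hc⟩ := h1.ae_eq_const
  refine ⟨fun x => (∫ t in (0 : ℝ)..x, g t) + c, ⟨h.2.1, fun a b => ?_⟩, ?_⟩
  · rw [hP.2]; ring
  · filter_upwards [hc] with x hx
    simp only [Pi.add_apply, Pi.neg_apply] at hx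
    linarith

/-! ### Differential inequalities on a half-line and decay -/

theorem monotoneOn_Ici_of_hasDerivAt {f f' : ℝ → ℝ} {a : ℝ} (hf : ∀ x, HasDerivAt f (f' x) x)
    (h : ∀ x, a ≤ x → 0 ≤ f' x) : MonotoneOn f (Ici a) := by
  refine monotoneOn_of_deriv_nonneg (convex_Ici a)
    (fun x _ => (hf x).continuousAt.continuousWithinAt)
    (fun x _ => (hf x).differentiableAt.differentiableWithinAt) fun x hx => ?_
  rw [interior_Ici] at hx
  rw [(hf x).deriv]
  exact h x (le_of_lt hx)

section HalfLine

variable {u u' u'' : ℝ → ℝ} {a c : ℝ}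

/-- A positive function with `u'' ≥ c u³` on a half-line cannot increase there, since it would
blow up at a finite point. -/
theorem deriv_nonpos_of_cubic_le (hc : 0 < c) (hu : ∀ x, HasDerivAt u (u' x) x)
    (hu' : ∀ x, HasDerivAt u' (u'' x) x) (pos : ∀ x, 0 < u x)
    (h : ∀ x, a ≤ x → c * u x ^ 3 ≤ u'' x) : ∀ x, a ≤ x → u' x ≤ 0 := by
  intro x₁ hx₁
  by_contra! hm
  have mono' : MonotoneOn u' (Ici x₁) := monotoneOn_Ici_of_hasDerivAt hu' fun x hx =>
    (by have := pos x; positivity : 0 ≤ c * u x ^ 3).trans (h x (hx₁.trans hx))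
  have lb : ∀ x, x₁ ≤ x → u' x₁ ≤ u' x := fun x hx =>
    mono' self_mem_Ici (mem_Ici.2 hx) hx
  have growth : ∀ x, x₁ ≤ x → u' x₁ * (x - x₁) ≤ u x := by
    intro x hx
    have h1 : MonotoneOn (fun x => u x - u' x₁ * x) (Ici x₁) :=
      monotoneOn_Ici_of_hasDerivAt (f' := fun x => u' x - u' x₁)
        (fun x => ((hu x).sub ((hasDerivAt_id x).const_mul (u' x₁))).congr_deriv (by simp))
        fun x hx => sub_nonneg.2 (lb x hx)
    have h2 := h1 self_mem_Ici (mem_Ici.2 hx) hx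
    simp only at h2
    nlinarith [pos x₁]
  -- First integral: multiply u'' ≥ c u³ by 2u' ≥ 0.
  have energy : ∀ x, x₁ ≤ x → c / 2 * u x ^ 4 - c / 2 * u x₁ ^ 4 ≤ u' x ^ 2 := by
    intro x hx
    have h1 : MonotoneOn (fun x => u' x ^ 2 - c / 2 * u x ^ 4) (Ici x₁) := by
      refine monotoneOn_Ici_of_hasDerivAt
        (f' := fun x => 2 * u' x * u'' x - 2 * c * u x ^ 3 * u' x) (fun x => ?_) fun x hx => ?_
      · refine (((hu' x).pow 2).sub (((hu x).pow 4).const_mul (c / 2))).congr_deriv ?_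
        push_cast; ring
      · have h2 := h x (hx₁.trans hx)
        have h3 := hm.le.trans (lb x hx)
        nlinarith
    have h2 := h1 self_mem_Ici (mem_Ici.2 hx) hx
    simp only at h2
    nlinarith [sq_nonneg (u' x₁)]
  have ev : ∃ x₂, x₁ ≤ x₂ ∧ ∀ x, x₂ ≤ x → 2 * u x₁ ≤ u x := by
    refine ⟨x₁ + 2 * u x₁ / u' x₁, by have := pos x₁; linarith [div_pos (mul_pos two_pos this) hm],
      fun x hx => ?_⟩
    have h0 : 0 < 2 * u x₁ / u' x₁ := div_pos (mul_pos two_pos (pos x₁)) hm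
    refine le_trans ?_ (growth x (by linarith))
    have h1 : 2 * u x₁ / u' x₁ ≤ x - x₁ := by linarith
    rw [div_le_iff₀ hm] at h1
    linarith
  obtain ⟨x₂, h12, hx₂⟩ := ev
  -- Past x₂ the constant u(x₁)⁴ is at most u⁴/16, so u'² ≥ (15/32)c u⁴ ≥ (c/4)u⁴.
  have fast : ∀ x, x₂ ≤ x → √c / 2 * u x ^ 2 ≤ u' x := by
    intro x hx
    have h1 := energy x (h12.trans hx)
    have h2 : u x₁ ^ 4 * 16 ≤ u x ^ 4 := by
      have := pow_le_pow_left₀ (mul_pos two_pos (pos x₁)).le (hx₂ x hx) 4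
      linarith [mul_pow 2 (u x₁) 4]
    have h3 := hm.le.trans (lb x (h12.trans hx))
    refine (sq_le_sq₀ (by have := pos x; positivity) h3).1 ?_
    rw [mul_pow, div_pow, Real.sq_sqrt hc.le]
    nlinarith [pow_pos (pos x) 4]
  set k := √c / 2 with hk
  have kpos : 0 < k := half_pos (Real.sqrt_pos.2 hc)
  -- Riccati blow-up: 1/u decreases at rate at least k, so it could not stay positive at x₂ + 1/(k
  -- u(x₂)).
  have h1 : MonotoneOn (fun x => -(u x)⁻¹ - k * x) (Ici x₂) := by
    refine monotoneOn_Ici_of_hasDerivAt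
      (f' := fun x => u' x / u x ^ 2 - k) (fun x => ?_) fun x hx => ?_
    · refine (((hu x).inv (pos x).ne').neg.sub ((hasDerivAt_id x).const_mul k)).congr_deriv ?_
      simp [neg_div]
    · rw [sub_nonneg, le_div_iff₀ (pow_pos (pos x) 2)]
      exact fast x hx
  have hd : 0 < (u x₂)⁻¹ / k := div_pos (inv_pos.2 (pos x₂)) kpos
  have h2 := h1 self_mem_Ici (mem_Ici.2 (by linarith : x₂ ≤ x₂ + (u x₂)⁻¹ / k)) (by linarith)
  simp only [mul_add, mul_div_cancel₀ _ kpos.ne'] at h2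
  have h3 := inv_pos.2 (pos (x₂ + (u x₂)⁻¹ / k))
  linarith

/-- If u' + u were positive somewhere it would grow exponentially from there, because (u' + u)' ≥ u'
+ u. But u' ≤ 0 keeps u' + u below the initial value of u. -/
theorem deriv_le_neg_self (hu : ∀ x, HasDerivAt u (u' x) x)
    (hu' : ∀ x, HasDerivAt u' (u'' x) x) (pos : ∀ x, 0 < u x)
    (hneg : ∀ x, a ≤ x → u' x ≤ 0) (h : ∀ x, a ≤ x → u x ≤ u'' x) :
    ∀ x, a ≤ x → u' x ≤ -u x := by
  intro x₁ hx₁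
  by_contra! hm
  have h1 : MonotoneOn (fun x => (u' x + u x) * Real.exp (-x)) (Ici x₁) := by
    refine monotoneOn_Ici_of_hasDerivAt
      (f' := fun x => (u'' x - u x) * Real.exp (-x)) (fun x => ?_) fun x hx => ?_
    · refine (((hu' x).add (hu x)).mul (hasDerivAt_id x).neg.exp).congr_deriv ?_
      simp; ring
    · exact mul_nonneg (sub_nonneg.2 (h x (hx₁.trans hx))) (Real.exp_pos _).le
  have hs : 0 < u' x₁ + u x₁ := by linarith
  -- With this t, the bound exp t ≥ 1 + t already pushes u' + u above u(x₁).
  set t := u x₁ / (u' x₁ + u x₁) with ht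
  have tpos : 0 < t := div_pos (pos x₁) hs
  have h2 := h1 self_mem_Ici (mem_Ici.2 (by linarith : x₁ ≤ x₁ + t)) (by linarith)
  simp only at h2
  have h3 : (u' x₁ + u x₁) * Real.exp t ≤ u' (x₁ + t) + u (x₁ + t) := by
    have e : Real.exp (-x₁) = Real.exp t * Real.exp (-(x₁ + t)) := by
      rw [← Real.exp_add]; congr 1; ring
    rw [e, ← mul_assoc] at h2
    exact le_of_mul_le_mul_right h2 (Real.exp_pos _)
  have h4 := mul_le_mul_of_nonneg_left (Real.add_one_le_exp t) hs.le
  have h5 : (u' x₁ + u x₁) * t = u x₁ := mul_div_cancel₀ _ hs.ne'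
  have h6 := hneg (x₁ + t) (by linarith)
  have h7 : MonotoneOn (fun x => -u x) (Ici x₁) :=
    monotoneOn_Ici_of_hasDerivAt (f' := fun x => -u' x) (fun x => (hu x).neg)
      fun x hx => neg_nonneg.2 (hneg x (hx₁.trans hx))
  have h8 := h7 self_mem_Ici (mem_Ici.2 (by linarith : x₁ ≤ x₁ + t)) (by linarith)
  simp only at h8
  linarith

theorem le_mul_exp_neg (hu : ∀ x, HasDerivAt u (u' x) x) (h : ∀ x, a ≤ x → u' x ≤ -u x) :
    ∀ x, a ≤ x → u x ≤ u a * Real.exp a * Real.exp (-x) := by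
  intro x hx
  have h1 : MonotoneOn (fun x => -(u x * Real.exp x)) (Ici a) := by
    refine monotoneOn_Ici_of_hasDerivAt
      (f' := fun x => -((u' x + u x) * Real.exp x)) (fun x => ?_) fun x hx => ?_
    · refine ((hu x).mul (Real.hasDerivAt_exp x)).neg.congr_deriv ?_
      ring
    · have := h x hx
      exact neg_nonneg.2 (mul_nonpos_of_nonpos_of_nonneg (by linarith) (Real.exp_pos _).le)
  have h2 := h1 self_mem_Ici (mem_Ici.2 hx) hx
  simp only [neg_le_neg_iff] at h2
  rw [Real.exp_neg, ← div_eq_mul_inv, le_div_iff₀ (Real.exp_pos _)]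
  exact h2

/-- A positive function with `u'' ≤ C x² u` on a half-line cannot decrease faster than a
Gaussian. -/
theorem neg_mul_le_deriv {C : ℝ} (hC : 0 ≤ C) (ha : 1 ≤ a) (hu : ∀ x, HasDerivAt u (u' x) x)
    (hu' : ∀ x, HasDerivAt u' (u'' x) x) (pos : ∀ x, 0 < u x)
    (h : ∀ x, a ≤ x → u'' x ≤ C * x ^ 2 * u x) :
    ∀ x, a ≤ x → -((C + 1) * x * u x) ≤ u' x := by
  intro x₁ hx₁
  by_contra! hm
  set K := C + 1 with hK
  set m := u' x₁ + K * x₁ * u x₁ with hmdef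
  have hmneg : m < 0 := by linarith
  -- The Gaussian factor cancels the Kxu' term. For x ≥ 1 the remaining coefficient Cx² + K − K²x²
  -- is nonpositive, so u' stays below m < 0 and u would reach 0.
  have h1 : MonotoneOn (fun x => -((u' x + K * x * u x) * Real.exp (-(K / 2 * x ^ 2))))
      (Ici x₁) := by
    refine monotoneOn_Ici_of_hasDerivAt
      (f' := fun x => -((u'' x + K * u x - K ^ 2 * x ^ 2 * u x)
        * Real.exp (-(K / 2 * x ^ 2)))) (fun x => ?_) fun x hx => ?_
    · have e1 := (hu' x).add (((hasDerivAt_id x).const_mul K).mul (hu x))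
      have e2 := (((hasDerivAt_id x).pow 2).const_mul (K / 2)).neg.exp
      refine ((e1.mul e2).neg).congr_deriv ?_
      simp; ring
    · refine neg_nonneg.2 (mul_nonpos_of_nonpos_of_nonneg ?_ (Real.exp_pos _).le)
      have h2 := h x (hx₁.trans hx)
      have h3 : C * x ^ 2 + K - K ^ 2 * x ^ 2 ≤ 0 := by
        have : 1 ≤ x := ha.trans (hx₁.trans hx)
        have h4 : 0 ≤ x ^ 2 - 1 := by nlinarith
        rw [hK]
        nlinarith [mul_nonneg (by positivity : 0 ≤ C ^ 2 + C + 1) h4]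
      nlinarith [pos x]
  have h2 : ∀ x, x₁ ≤ x → u' x ≤ m := by
    intro x hx
    have h3 := h1 self_mem_Ici (mem_Ici.2 hx) hx
    simp only [neg_le_neg_iff] at h3
    have h4 : Real.exp (-(K / 2 * x ^ 2)) ≤ Real.exp (-(K / 2 * x₁ ^ 2)) := by
      refine Real.exp_le_exp.2 ?_
      have : x₁ ^ 2 ≤ x ^ 2 := pow_le_pow_left₀ (by linarith) hx 2
      nlinarith
    have h5 : (u' x + K * x * u x) * Real.exp (-(K / 2 * x ^ 2))
        ≤ m * Real.exp (-(K / 2 * x ^ 2)) :=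
      h3.trans (mul_le_mul_of_nonpos_left h4 hmneg.le)
    have h6 := le_of_mul_le_mul_right h5 (Real.exp_pos _)
    have h7 : 0 ≤ K * x * u x := by
      have := pos x
      have : 0 ≤ x := by linarith
      positivity
    linarith
  have h3 : MonotoneOn (fun x => m * x - u x) (Ici x₁) :=
    monotoneOn_Ici_of_hasDerivAt (f' := fun x => m - u' x)
      (fun x => (((hasDerivAt_id x).const_mul m).sub (hu x)).congr_deriv (by simp))
      fun x hx => sub_nonneg.2 (h2 x hx)
  have hd : 0 < u x₁ / -m := div_pos (pos x₁) (neg_pos.2 hmneg)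
  have h4 := h3 self_mem_Ici (mem_Ici.2 (by linarith : x₁ ≤ x₁ + u x₁ / -m)) (by linarith)
  have h5 : m * (u x₁ / -m) = -u x₁ := by
    rw [div_neg, mul_neg, mul_div_cancel₀ _ hmneg.ne]
  simp only [mul_add, h5] at h4
  linarith [pos (x₁ + u x₁ / -m)]

end HalfLine

/-- Near `+∞` the positive function `u` with derivative `u'` decays exponentially, and its
logarithmic derivative grows at most linearly. -/
def ControlledDecay (u u' : ℝ → ℝ) : Prop :=
  ∃ K A, 0 ≤ K ∧ ∀ᶠ x in atTop, |u' x| ≤ K * x * u x ∧ u x ≤ A * Real.exp (-x)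

/-- From x = 1 on, the linear coefficient x² − 1 + h is nonnegative, leaving u'' ≥ ε⁻²u³. -/
theorem deriv_nonpos_of_eqn {ε : ℝ} (hε : 0 < ε) {u u' u'' h : ℝ → ℝ}
    (hu : ∀ x, HasDerivAt u (u' x) x) (hu' : ∀ x, HasDerivAt u' (u'' x) x)
    (pos : ∀ x, 0 < u x) (h0 : ∀ x, 0 ≤ h x)
    (eqn : ∀ x, ε ^ 2 * u'' x = (x ^ 2 - 1 + u x ^ 2 + h x) * u x) :
    ∀ x, 1 ≤ x → u' x ≤ 0 := by
  refine deriv_nonpos_of_cubic_le (c := (ε ^ 2)⁻¹) (by positivity) hu hu' pos fun x hx => ?_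
  rw [inv_mul_le_iff₀ (by positivity), eqn]
  have h1 : 0 ≤ x ^ 2 - 1 := by nlinarith
  nlinarith [mul_nonneg (add_nonneg h1 (h0 x)) (pos x).le]

theorem apply_le_apply_one_of_eqn {ε : ℝ} (hε : 0 < ε) {u u' u'' h : ℝ → ℝ}
    (hu : ∀ x, HasDerivAt u (u' x) x) (hu' : ∀ x, HasDerivAt u' (u'' x) x)
    (pos : ∀ x, 0 < u x) (h0 : ∀ x, 0 ≤ h x)
    (eqn : ∀ x, ε ^ 2 * u'' x = (x ^ 2 - 1 + u x ^ 2 + h x) * u x) :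
    ∀ x, 1 ≤ x → u x ≤ u 1 := by
  intro x hx
  have h7 : MonotoneOn (fun x => -u x) (Ici 1) :=
    monotoneOn_Ici_of_hasDerivAt (f' := fun x => -u' x) (fun x => (hu x).neg)
      fun x hx => neg_nonneg.2 (deriv_nonpos_of_eqn hε hu hu' pos h0 eqn x hx)
  exact neg_le_neg_iff.1 (h7 self_mem_Ici (mem_Ici.2 hx) hx)

theorem controlledDecay_of_eqn {ε M : ℝ} (hε : 0 < ε) {u u' u'' h : ℝ → ℝ}
    (hu : ∀ x, HasDerivAt u (u' x) x) (hu' : ∀ x, HasDerivAt u' (u'' x) x)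
    (pos : ∀ x, 0 < u x) (h0 : ∀ x, 0 ≤ h x) (hM : ∀ x, 1 ≤ x → h x ≤ M)
    (eqn : ∀ x, ε ^ 2 * u'' x = (x ^ 2 - 1 + u x ^ 2 + h x) * u x) :
    ControlledDecay u u' := by
  have hneg := deriv_nonpos_of_eqn hε hu hu' pos h0 eqn
  have hle := apply_le_apply_one_of_eqn hε hu hu' pos h0 eqn
  have hM0 : 0 ≤ M := (h0 1).trans (hM 1 le_rfl)
  -- For x ≥ 1 + ε one has x² − 1 ≥ ε², hence u'' ≥ u.
  have h2 : ∀ x, 1 + ε ≤ x → u' x ≤ -u x := by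
    refine deriv_le_neg_self hu hu' pos (fun x hx => hneg x (by linarith)) fun x hx => ?_
    refine le_of_mul_le_mul_left ?_ (sq_pos_of_pos hε)
    rw [eqn]
    refine mul_le_mul_of_nonneg_right ?_ (pos x).le
    nlinarith [h0 x, sq_nonneg (u x)]
  have h3 : ∀ x, 1 ≤ x → -(((1 + u 1 ^ 2 + M) / ε ^ 2 + 1) * x * u x) ≤ u' x := by
    refine neg_mul_le_deriv (by positivity) le_rfl hu hu' pos fun x hx => ?_
    refine le_of_mul_le_mul_left ?_ (sq_pos_of_pos hε)
    rw [eqn]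
    have e : ε ^ 2 * ((1 + u 1 ^ 2 + M) / ε ^ 2 * x ^ 2 * u x) =
      ((1 + u 1 ^ 2 + M) * x ^ 2) * u x := by field_simp
    rw [e]
    refine mul_le_mul_of_nonneg_right ?_ (pos x).le
    have h4 : u x ^ 2 ≤ u 1 ^ 2 := pow_le_pow_left₀ (pos x).le (hle x hx) 2
    have h5 : 1 ≤ x ^ 2 := by nlinarith
    nlinarith [hM x hx, mul_nonneg (add_nonneg (sq_nonneg (u 1)) hM0) (sub_nonneg.2 h5)]
  refine ⟨(1 + u 1 ^ 2 + M) / ε ^ 2 + 1, u (1 + ε) * Real.exp (1 + ε), by positivity, ?_⟩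
  filter_upwards [eventually_ge_atTop (1 + ε)] with x hx
  have hx1 : 1 ≤ x := by linarith
  refine ⟨abs_le.2 ⟨h3 x hx1, (hneg x hx1).trans ?_⟩, le_mul_exp_neg hu h2 x hx⟩
  have := pos x
  positivity

/-! ### The Brezis-Oswald identity -/

/-- The boundary term in the Brezis-Oswald identity for two positive functions. -/
noncomputable def brezisOswald (u u' w w' : ℝ → ℝ) (x : ℝ) : ℝ :=
  (w' x / w x - u' x / u x) * (w x ^ 2 - u x ^ 2)

theorem hasDerivAt_brezisOswald {u u' u'' w w' w'' : ℝ → ℝ} {x : ℝ}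
    (hu : HasDerivAt u (u' x) x) (hu' : HasDerivAt u' (u'' x) x)
    (hw : HasDerivAt w (w' x) x) (hw' : HasDerivAt w' (w'' x) x)
    (pu : 0 < u x) (pw : 0 < w x) :
    HasDerivAt (brezisOswald u u' w w')
      ((w'' x / w x - u'' x / u x) * (w x ^ 2 - u x ^ 2)
        + (w' x / w x - u' x / u x) ^ 2 * (w x ^ 2 + u x ^ 2)) x := by
  have h1 := (((hw'.div hw pw.ne').sub (hu'.div hu pu.ne')).mul ((hw.pow 2).sub (hu.pow 2)))
  refine h1.congr_deriv ?_
  have := pu.ne'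
  have := pw.ne'
  simp only [Pi.sub_apply, Pi.div_apply, Pi.pow_apply]
  field_simp
  push_cast
  ring

/-- The logarithmic derivatives are O(x), while u² and w² are exponentially small. -/
theorem tendsto_brezisOswald {u u' w w' : ℝ → ℝ} (pu : ∀ x, 0 < u x) (pw : ∀ x, 0 < w x)
    (hu : ControlledDecay u u') (hw : ControlledDecay w w') :
    Tendsto (brezisOswald u u' w w') atTop (𝓝 0) := by
  obtain ⟨K, A, hK, h1⟩ := hu
  obtain ⟨L, B, hL, h2⟩ := hw
  have lim : Tendsto (fun x : ℝ => (L + K) * (A ^ 2 + B ^ 2) * (x ^ 1 * Real.exp (-x))) atTop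
      (𝓝 ((L + K) * (A ^ 2 + B ^ 2) * 0)) :=
    (Real.tendsto_pow_mul_exp_neg_atTop_nhds_zero 1).const_mul _
  rw [mul_zero] at lim
  refine squeeze_zero_norm' ?_ lim
  filter_upwards [h1, h2, eventually_ge_atTop 0] with x ⟨a1, a2⟩ ⟨b1, b2⟩ hx
  have pux := pu x
  have pwx := pw x
  rw [brezisOswald, Real.norm_eq_abs, abs_mul]
  have c1 : |u' x / u x| ≤ K * x := by
    rw [abs_div, abs_of_pos pux, div_le_iff₀ pux]; exact a1
  have c2 : |w' x / w x| ≤ L * x := by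
    rw [abs_div, abs_of_pos pwx, div_le_iff₀ pwx]; exact b1
  have c3 : |w' x / w x - u' x / u x| ≤ (L + K) * x := by
    have := abs_sub (w' x / w x) (u' x / u x)
    linarith
  have e0 : Real.exp (-x) ^ 2 ≤ Real.exp (-x) := by
    have : Real.exp (-x) ≤ 1 := Real.exp_le_one_iff.2 (by linarith)
    nlinarith [Real.exp_pos (-x)]
  have c4 : |w x ^ 2 - u x ^ 2| ≤ (A ^ 2 + B ^ 2) * Real.exp (-x) := by
    have d1 : u x ^ 2 ≤ A ^ 2 * Real.exp (-x) := by
      have := pow_le_pow_left₀ pux.le a2 2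
      rw [mul_pow] at this
      exact this.trans (mul_le_mul_of_nonneg_left e0 (sq_nonneg _))
    have d2 : w x ^ 2 ≤ B ^ 2 * Real.exp (-x) := by
      have := pow_le_pow_left₀ pwx.le b2 2
      rw [mul_pow] at this
      exact this.trans (mul_le_mul_of_nonneg_left e0 (sq_nonneg _))
    rw [abs_le]
    constructor <;> nlinarith [sq_nonneg (u x), sq_nonneg (w x)]
  calc _ ≤ ((L + K) * x) * ((A ^ 2 + B ^ 2) * Real.exp (-x)) :=
        mul_le_mul c3 c4 (abs_nonneg _) (by positivity)
    _ = _ := by ring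

/-! ### The scalar energy space -/

theorem weakDeriv_congr {f g : ℝ → ℝ} (h : f =ᵐ[volume] g) (hf : ∃ f', HasWeakDeriv f f') :
    weakDeriv f =ᵐ[volume] weakDeriv g := by
  obtain ⟨f', hf'⟩ := hf
  exact hf'.weakDeriv_ae_eq.trans (hf'.congr h).weakDeriv_ae_eq.symm

namespace MemScalarEnergySpace

variable {f g : ℝ → ℝ}

theorem hasWeakDeriv (hf : MemScalarEnergySpace f) : HasWeakDeriv f (weakDeriv f) := by
  obtain ⟨f', h1, _⟩ := hf.exists_weakDeriv
  have h2 := h1.weakDeriv_ae_eq.symm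
  refine ⟨h1.1, h1.2.1.congr h2, fun φ hφ hc => ?_⟩
  rw [h1.2.2 φ hφ hc]
  congr 1
  refine integral_congr_ae ?_
  filter_upwards [h2] with x hx
  rw [hx]

theorem memLp_weakDeriv (hf : MemScalarEnergySpace f) : MemLp (weakDeriv f) 2 volume := by
  obtain ⟨f', h1, h2⟩ := hf.exists_weakDeriv
  exact h2.ae_eq h1.weakDeriv_ae_eq.symm

theorem congr (hf : MemScalarEnergySpace f) (h : f =ᵐ[volume] g) : MemScalarEnergySpace g := by
  refine ⟨hf.memLp.ae_eq h, hf.memLp_weight.ae_eq ?_, ?_⟩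
  · filter_upwards [h] with x hx
    rw [hx]
  · exact ⟨_, hf.hasWeakDeriv.congr h, hf.memLp_weakDeriv⟩

theorem add (hf : MemScalarEnergySpace f) (hg : MemScalarEnergySpace g) :
    MemScalarEnergySpace (f + g) := by
  refine ⟨hf.memLp.add hg.memLp, ?_, _, hf.hasWeakDeriv.add hg.hasWeakDeriv,
    hf.memLp_weakDeriv.add hg.memLp_weakDeriv⟩
  convert hf.memLp_weight.add hg.memLp_weight using 1
  funext x
  simp [mul_add]

theorem const_smul (hf : MemScalarEnergySpace f) (c : ℝ) : MemScalarEnergySpace (c • f) := by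
  refine ⟨hf.memLp.const_smul c, ?_, _, hf.hasWeakDeriv.const_smul c,
    hf.memLp_weakDeriv.const_smul c⟩
  convert hf.memLp_weight.const_smul c using 1
  funext x
  simp [mul_left_comm]

theorem weakDeriv_add (hf : MemScalarEnergySpace f) (hg : MemScalarEnergySpace g) :
    weakDeriv (f + g) =ᵐ[volume] weakDeriv f + weakDeriv g :=
  (hf.hasWeakDeriv.add hg.hasWeakDeriv).weakDeriv_ae_eq

theorem weakDeriv_const_smul (hf : MemScalarEnergySpace f) (c : ℝ) :
    weakDeriv (c • f) =ᵐ[volume] c • weakDeriv f :=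
  (hf.hasWeakDeriv.const_smul c).weakDeriv_ae_eq

theorem exists_bound (hf : MemScalarEnergySpace f) : ∃ M, ∀ᵐ x, |f x| ≤ M := by
  obtain ⟨F, hF, h⟩ := hf.hasWeakDeriv.exists_isPrimitive
  obtain ⟨M, hM⟩ := hF.exists_bound (hf.memLp.ae_eq h) hf.memLp_weakDeriv
  refine ⟨M, ?_⟩
  filter_upwards [h] with x hx
  rw [hx]
  exact hM x

/-- One factor is bounded by the Sobolev embedding. Consequently all quartic terms of the energy are
integrable. -/
theorem memLp_mul (hf : MemScalarEnergySpace f) (hg : MemScalarEnergySpace g) :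
    MemLp (fun x => f x * g x) 2 volume := by
  obtain ⟨M, hM⟩ := hf.exists_bound
  refine hg.memLp.of_le_mul (c := M) (hf.memLp.1.mul hg.memLp.1) ?_
  filter_upwards [hM] with x hx
  rw [norm_mul]
  exact mul_le_mul_of_nonneg_right hx (norm_nonneg _)

theorem integrable_mul_mul {u v : ℝ → ℝ} (hf : MemScalarEnergySpace f)
    (hg : MemScalarEnergySpace g) (hu : MemScalarEnergySpace u) (hv : MemScalarEnergySpace v) :
    Integrable fun x => f x * g x * (u x * v x) :=
  (hf.memLp_mul hg).integrable_mul (hu.memLp_mul hv)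

theorem integrable_weight (hf : MemScalarEnergySpace f) :
    Integrable fun x => x ^ 2 * f x ^ 2 := by
  convert hf.memLp_weight.integrable_sq using 1
  funext x
  rw [mul_pow, sq_abs]

end MemScalarEnergySpace

/-! ### The ground state and its quadratic form -/

theorem hasDerivAt_of_contDiff_two {f : ℝ → ℝ} (hf : ContDiff ℝ 2 f) (x : ℝ) :
    HasDerivAt f (deriv f x) x :=
  (hf.differentiable two_ne_zero).differentiableAt.hasDerivAt

theorem contDiff_one_deriv {f : ℝ → ℝ} (hf : ContDiff ℝ 2 f) : ContDiff ℝ 1 (deriv f) := by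
  have h : ContDiff ℝ (1 + 1) f := by
    rw [one_add_one_eq_two]; exact hf
  exact (contDiff_succ_iff_deriv.1 h).2.2

theorem hasDerivAt_deriv_of_contDiff_two {f : ℝ → ℝ} (hf : ContDiff ℝ 2 f) (x : ℝ) :
    HasDerivAt (deriv f) (deriv (deriv f) x) x :=
  ((contDiff_one_deriv hf).differentiable one_ne_zero).differentiableAt.hasDerivAt

theorem hasDerivAt_comp_neg {f f' : ℝ → ℝ} (hf : ∀ x, HasDerivAt f (f' x) x) (x : ℝ) :
    HasDerivAt (fun x => f (-x)) (-f' (-x)) x := by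
  exact ((hf (-x)).scomp x (hasDerivAt_neg x)).congr_deriv (by simp)

theorem hasDerivAt_neg_comp_neg {f f' : ℝ → ℝ} (hf : ∀ x, HasDerivAt f (f' x) x) (x : ℝ) :
    HasDerivAt (fun x => -f (-x)) (f' (-x)) x := by
  exact (hasDerivAt_comp_neg hf x).neg.congr_deriv (by simp)

/-- The quadratic form whose ground state is `η`. -/
noncomputable def scalarForm (ε : ℝ) (η f : ℝ → ℝ) : ℝ :=
  ∫ x, (ε ^ 2 * weakDeriv f x ^ 2 + (x ^ 2 - 1 + η x ^ 2) * f x ^ 2)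

namespace IsGroundState

variable {ε : ℝ} {η f : ℝ → ℝ}

theorem eqn' (hη : IsGroundState ε η) (x : ℝ) :
    ε ^ 2 * deriv (deriv η) x = (x ^ 2 - 1 + η x ^ 2 + 0) * η x := by
  linarith [hη.eqn x]

theorem isPrimitive (hη : IsGroundState ε η) : IsPrimitive η (deriv η) :=
  IsPrimitive.of_contDiff (hη.contDiff.of_le one_le_two)

theorem weakDeriv_ae_eq (hη : IsGroundState ε η) : weakDeriv η =ᵐ[volume] deriv η :=
  hη.isPrimitive.hasWeakDeriv.weakDeriv_ae_eq

theorem contDiff_logDeriv (hη : IsGroundState ε η) :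
    ContDiff ℝ 1 fun x => deriv η x / η x :=
  (contDiff_one_deriv hη.contDiff).div (hη.contDiff.of_le one_le_two) fun x => (hη.pos x).ne'

/-- The Riccati equation of p = η'/η, equivalent to the linear equation with η² frozen in the
potential. -/
theorem hasDerivAt_logDeriv (hη : IsGroundState ε η) (hε : 0 < ε) (x : ℝ) :
    HasDerivAt (fun x => deriv η x / η x)
      ((x ^ 2 - 1 + η x ^ 2) / ε ^ 2 - (deriv η x / η x) ^ 2) x := by
  refine ((hasDerivAt_deriv_of_contDiff_two hη.contDiff x).div
    (hasDerivAt_of_contDiff_two hη.contDiff x) (hη.pos x).ne').congr_deriv ?_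
  have h1 := hη.eqn' x
  have h2 := (hη.pos x).ne'
  have h3 : deriv (deriv η) x = (x ^ 2 - 1 + η x ^ 2) * η x / ε ^ 2 := by
    field_simp
    linarith
  rw [h3]
  field_simp

/-- The decay estimates, applied to η and to its reflection, control both ends, and continuity
controls the middle. Linear growth is what makes p f square integrable under the weight |x|. -/
theorem exists_logDeriv_bound (hη : IsGroundState ε η) (hε : 0 < ε) :
    ∃ K, ∀ x, |deriv η x / η x| ≤ K * (1 + |x|) := by
  have d1 := hasDerivAt_of_contDiff_two hη.contDiff
  have d2 := hasDerivAt_deriv_of_contDiff_two hη.contDiff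
  obtain ⟨K, _, hK, h1⟩ := controlledDecay_of_eqn hε d1 d2 hη.pos (h := 0) (M := 0)
    (fun _ => le_rfl) (fun _ _ => le_rfl) hη.eqn'
  obtain ⟨L, _, hL, h2⟩ := controlledDecay_of_eqn hε (hasDerivAt_comp_neg d1)
    (hasDerivAt_neg_comp_neg d2) (fun x => hη.pos (-x)) (h := 0) (M := 0)
    (fun _ => le_rfl) (fun _ _ => le_rfl) (fun x => by simpa using hη.eqn' (-x))
  obtain ⟨R, hR⟩ := eventually_atTop.1 (h1.and h2)
  obtain ⟨C, hC⟩ := (isCompact_Icc (a := -|R|) (b := |R|)).exists_bound_of_continuousOn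
    hη.contDiff_logDeriv.continuous.continuousOn
  refine ⟨K + L + |C|, fun x => ?_⟩
  have hx0 := abs_nonneg x
  have hC0 := abs_nonneg C
  rcases le_or_gt |x| |R| with hx | hx
  · have h3 := hC x (abs_le.1 hx)
    rw [Real.norm_eq_abs] at h3
    nlinarith [le_abs_self C, mul_nonneg hK hx0, mul_nonneg hL hx0, mul_nonneg hC0 hx0]
  · have hpos := hη.pos x
    rw [abs_div, abs_of_pos hpos, div_le_iff₀ hpos]
    have h3 : |deriv η x| ≤ (K + L) * |x| * η x := by
      have hRx : R ≤ |x| := (le_abs_self R).trans hx.le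
      rcases le_total 0 x with h0 | h0
      · rw [abs_of_nonneg h0] at hRx ⊢
        have := (hR x hRx).1.1
        nlinarith [mul_nonneg (mul_nonneg hL h0) hpos.le]
      · rw [abs_of_nonpos h0] at hRx ⊢
        have := (hR (-x) hRx).2.1
        simp only [neg_neg, abs_neg] at this
        nlinarith [mul_nonneg (mul_nonneg hK (neg_nonneg.2 h0)) hpos.le]
    have h4 : (K + L) * |x| ≤ (K + L + |C|) * (1 + |x|) := by
      nlinarith [mul_nonneg hC0 hx0]
    exact h3.trans (mul_le_mul_of_nonneg_right h4 hpos.le)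

theorem memLp_logDeriv_mul (hη : IsGroundState ε η) (hε : 0 < ε) (hf : MemScalarEnergySpace f) :
    MemLp (fun x => deriv η x / η x * f x) 2 volume := by
  obtain ⟨K, hK⟩ := hη.exists_logDeriv_bound hε
  refine (hf.memLp.norm.add hf.memLp_weight.norm).of_le_mul (c := K)
    (hη.contDiff_logDeriv.continuous.aestronglyMeasurable.mul hf.memLp.1)
    (Eventually.of_forall fun x => ?_)
  have e : ‖((fun x => ‖f x‖) + fun x => ‖|x| * f x‖) x‖ = (1 + |x|) * |f x| := by
    simp only [Pi.add_apply, norm_mul, Real.norm_eq_abs, abs_abs]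
    rw [abs_of_nonneg (by positivity)]
    ring
  rw [e, norm_mul, Real.norm_eq_abs, Real.norm_eq_abs, ← mul_assoc]
  exact mul_le_mul_of_nonneg_right (hK x) (abs_nonneg _)

theorem integrable_scalarForm (hη : IsGroundState ε η) (hf : MemScalarEnergySpace f) :
    Integrable fun x => ε ^ 2 * weakDeriv f x ^ 2 + (x ^ 2 - 1 + η x ^ 2) * f x ^ 2 := by
  refine ((hf.memLp_weakDeriv.integrable_sq.const_mul (ε ^ 2)).add
    ((hf.integrable_weight.sub hf.memLp.integrable_sq).add
      (hη.mem.integrable_mul_mul hη.mem hf hf))).congr (Eventually.of_forall fun x => ?_)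
  simp only [Pi.add_apply, Pi.sub_apply]
  ring

/-- Jacobi identity: the quadratic form of the ground state is a perfect square. -/
theorem scalarForm_eq (hη : IsGroundState ε η) (hε : 0 < ε) (hf : MemScalarEnergySpace f) :
    scalarForm ε η f = ε ^ 2 * ∫ x, (weakDeriv f x - deriv η x / η x * f x) ^ 2 := by
  obtain ⟨F, hF, hfF⟩ := hf.hasWeakDeriv.exists_isPrimitive
  set p := fun x => deriv η x / η x with hp
  have iS := ((hf.memLp_weakDeriv.sub (hη.memLp_logDeriv_mul hε hf)).integrable_sq).const_mul
    (ε ^ 2)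
  have iQ := hη.integrable_scalarForm hf
  -- By the Riccati equation, (pF²)' is ε⁻² times the difference of the two integrands; pF² is
  -- integrable, so that difference integrates to 0.
  have hprim := (IsPrimitive.of_contDiff hη.contDiff_logDeriv).mul (hF.mul hF)
  have hval : (fun x => deriv p x * (F x * F x) + p x *
      (weakDeriv f x * F x + F x * weakDeriv f x)) =ᵐ[volume] fun x =>
        (ε ^ 2)⁻¹ * ((ε ^ 2 * weakDeriv f x ^ 2 + (x ^ 2 - 1 + η x ^ 2) * f x ^ 2)
          - ε ^ 2 * (weakDeriv f x - p x * f x) ^ 2) := by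
    filter_upwards [hfF] with x hx
    have e : deriv p x = (x ^ 2 - 1 + η x ^ 2) / ε ^ 2 - p x ^ 2 :=
      (hη.hasDerivAt_logDeriv hε x).deriv
    rw [e, hx]
    field_simp
    ring
  have hz := hprim.integral_eq_zero (((iQ.sub iS).const_mul _).congr hval.symm) (by
    refine ((hη.memLp_logDeriv_mul hε hf).integrable_mul hf.memLp).congr ?_
    filter_upwards [hfF] with x hx
    simp only [Pi.mul_apply]
    rw [hx]; ring)
  rw [integral_congr_ae hval, integral_const_mul] at hz
  have h1 : (ε ^ 2)⁻¹ ≠ 0 := by positivity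
  have h2 := (mul_eq_zero.1 hz).resolve_left h1
  have h3 := integral_sub iQ iS
  have h4 : scalarForm ε η f = ∫ x, ε ^ 2 * (weakDeriv f x - p x * f x) ^ 2 := by
    simp only [Pi.sub_apply] at h3
    exact sub_eq_zero.1 (h3.symm.trans h2)
  rw [h4, integral_const_mul]

theorem scalarForm_nonneg (hη : IsGroundState ε η) (hε : 0 < ε) (hf : MemScalarEnergySpace f) :
    0 ≤ scalarForm ε η f := by
  rw [hη.scalarForm_eq hε hf]
  exact mul_nonneg (sq_nonneg _) (integral_nonneg fun x => sq_nonneg _)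

theorem exists_eq_smul_of_scalarForm_eq_zero (hη : IsGroundState ε η) (hε : 0 < ε)
    (hf : MemScalarEnergySpace f) (h0 : scalarForm ε η f = 0) :
    ∃ c : ℝ, f =ᵐ[volume] c • η := by
  obtain ⟨F, hF, hfF⟩ := hf.hasWeakDeriv.exists_isPrimitive
  rw [hη.scalarForm_eq hε hf] at h0
  have h1 := (mul_eq_zero.1 h0).resolve_left (by positivity)
  replace h1 := (integral_eq_zero_iff_of_nonneg (fun x => sq_nonneg _)
    (hf.memLp_weakDeriv.sub (hη.memLp_logDeriv_mul hε hf)).integrable_sq).1 h1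
  have hpc := hη.contDiff_logDeriv.continuous.mul hF.continuous
  have h2 : ∀ x, HasDerivAt F (deriv η x / η x * F x) x := fun x => by
    -- A priori F' = pF holds only almost everywhere. As pF is continuous, this integral form
    -- upgrades it to every point.
    have e : F = fun x => F 0 + ∫ t in (0 : ℝ)..x, deriv η t / η t * F t := by
      funext y
      have : ∫ t in (0 : ℝ)..y, deriv η t / η t * F t = ∫ t in (0 : ℝ)..y, weakDeriv f t := by
        refine intervalIntegral.integral_congr_ae ?_
        filter_upwards [h1, hfF] with t ht hft _
        have ht' := pow_eq_zero_iff two_ne_zero |>.1 ht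
        simp only [Pi.sub_apply] at ht'
        rw [← hft]
        linarith
      rw [this, hF.2]; ring
    have := (intervalIntegral.integral_hasDerivAt_right (hpc.intervalIntegrable 0 x)
      hpc.stronglyMeasurable.stronglyMeasurableAtFilter hpc.continuousAt).const_add (F 0)
    exact (congrArg (fun G => HasDerivAt G (deriv η x / η x * F x) x) e).mpr this
  have h3 : ∀ x, HasDerivAt (fun x => F x / η x) 0 x := fun x => by
    refine ((h2 x).div (hasDerivAt_of_contDiff_two hη.contDiff x) (hη.pos x).ne').congr_deriv ?_
    have := (hη.pos x).ne'
    field_simp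
    ring
  refine ⟨F 0 / η 0, ?_⟩
  filter_upwards [hfF] with x hx
  have h4 := is_const_of_deriv_eq_zero (fun x => (h3 x).differentiableAt)
    (fun x => (h3 x).deriv) x 0
  rw [hx, Pi.smul_apply, smul_eq_mul, ← h4, div_mul_cancel₀ _ (hη.pos x).ne']

/-- The ground state is in the kernel of its quadratic form. -/
theorem scalarForm_smul_add (hη : IsGroundState ε η) (hε : 0 < ε) (hf : MemScalarEnergySpace f)
    (c t : ℝ) : scalarForm ε η (c • η + t • f) = t ^ 2 * scalarForm ε η f := by
  have hc := hη.mem.const_smul c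
  have ht := hf.const_smul t
  rw [hη.scalarForm_eq hε (hc.add ht), hη.scalarForm_eq hε hf, mul_left_comm,
    ← integral_const_mul (t ^ 2)]
  congr 1
  refine integral_congr_ae ?_
  filter_upwards [hc.weakDeriv_add ht, hη.mem.weakDeriv_const_smul c,
    hf.weakDeriv_const_smul t, hη.weakDeriv_ae_eq] with x h1 h2 h3 h4
  simp only [Pi.add_apply, Pi.smul_apply, smul_eq_mul] at *
  rw [h1, h2, h3, h4]
  have := (hη.pos x).ne'
  field_simp
  ring

end IsGroundState

/-! ### Splitting of the energy and the plane spanned by the ground state -/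

/-- The quartic part of the energy density, relative to the quadratic form of `η`. -/
noncomputable def potential (γ e a b : ℝ) : ℝ :=
  (1 / 2) * (a ^ 2 + b ^ 2) ^ 2 + (γ - 1) * (a ^ 2 * b ^ 2) - e ^ 2 * (a ^ 2 + b ^ 2)

theorem IsGroundState.integrable_potential {ε : ℝ} {η : ℝ → ℝ} (hη : IsGroundState ε η) (γ : ℝ)
    {f g : ℝ → ℝ} (hf : MemScalarEnergySpace f) (hg : MemScalarEnergySpace g) :
    Integrable fun x => potential γ (η x) (f x) (g x) := by
  have i1 := hf.integrable_mul_mul hf hf hf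
  have i2 := hf.integrable_mul_mul hf hg hg
  have i3 := hg.integrable_mul_mul hg hg hg
  have i4 := hη.mem.integrable_mul_mul hη.mem hf hf
  have i5 := hη.mem.integrable_mul_mul hη.mem hg hg
  refine ((((i1.const_mul (1 / 2)).add (i2.const_mul γ)).add (i3.const_mul (1 / 2))).sub
    (i4.add i5)).congr (Eventually.of_forall fun x => ?_)
  simp only [Pi.add_apply, Pi.sub_apply, potential]
  ring

theorem IsGroundState.energy_eq {ε : ℝ} {η : ℝ → ℝ} (hη : IsGroundState ε η) (γ : ℝ)
    {f g : ℝ → ℝ} (hf : MemScalarEnergySpace f) (hg : MemScalarEnergySpace g) :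
    energy ε γ (f, g) = (1 / 2) * (scalarForm ε η f + scalarForm ε η g
      + ∫ x, potential γ (η x) (f x) (g x)) := by
  have i1 := hη.integrable_scalarForm hf
  have i2 := hη.integrable_scalarForm hg
  have h := integral_add (i1.add i2) (hη.integrable_potential γ hf hg)
  simp only [Pi.add_apply] at h
  rw [energy, scalarForm, scalarForm, ← integral_add i1 i2, ← h]
  congr 2
  funext x
  simp only [potential]
  ring

/-- The energy on the plane spanned by the ground state, up to a factor. -/
noncomputable def reducedEnergy (γ a b : ℝ) : ℝ :=
  (1 / 2) * (a ^ 2 + b ^ 2) ^ 2 + (γ - 1) * (a ^ 2 * b ^ 2) - (a ^ 2 + b ^ 2)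

theorem potential_mul (γ e a b : ℝ) :
    potential γ e (a * e) (b * e) = reducedEnergy γ a b * e ^ 4 := by
  simp only [potential, reducedEnergy]
  ring

namespace IsGroundState

variable {ε : ℝ} {η : ℝ → ℝ}

theorem smul_mem_energySpace (hη : IsGroundState ε η) (a b : ℝ) :
    (a • η, b • η) ∈ energySpace :=
  ⟨hη.mem.const_smul a, hη.mem.const_smul b⟩

theorem scalarForm_smul (hη : IsGroundState ε η) (hε : 0 < ε) (c : ℝ) :
    scalarForm ε η (c • η) = 0 := by
  have h := hη.scalarForm_smul_add hε hη.mem c 0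
  simpa using h

theorem integrable_pow_four (hη : IsGroundState ε η) : Integrable fun x => η x ^ 4 :=
  (hη.mem.integrable_mul_mul hη.mem hη.mem hη.mem).congr
    (Eventually.of_forall fun x => by simp only; ring)

theorem integral_pow_four_pos (hη : IsGroundState ε η) : 0 < ∫ x, η x ^ 4 := by
  rw [integral_pos_iff_support_of_nonneg (fun x => pow_nonneg (hη.pos x).le 4)
    hη.integrable_pow_four]
  have : Function.support (fun x => η x ^ 4) = univ :=
    eq_univ_of_forall fun x => (pow_pos (hη.pos x) 4).ne'
  rw [this]
  simp

theorem energy_smul (hη : IsGroundState ε η) (hε : 0 < ε) (γ a b : ℝ) :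
    energy ε γ (a • η, b • η) = (1 / 2) * (reducedEnergy γ a b * ∫ x, η x ^ 4) := by
  rw [hη.energy_eq γ (hη.mem.const_smul a) (hη.mem.const_smul b), hη.scalarForm_smul hε,
    hη.scalarForm_smul hε, ← integral_const_mul]
  simp only [Pi.smul_apply, smul_eq_mul, potential_mul, zero_add]

theorem energyNorm_smul (hη : IsGroundState ε η) (a b : ℝ) :
    energyNorm (a • η, b • η) =
      √((a ^ 2 + b ^ 2) * ∫ x, (weakDeriv η x ^ 2 + (1 + x ^ 2) * η x ^ 2)) := by
  rw [energyNorm, ← integral_const_mul]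
  congr 1
  refine integral_congr_ae ?_
  filter_upwards [hη.mem.weakDeriv_const_smul a, hη.mem.weakDeriv_const_smul b] with x h1 h2
  simp only [Pi.smul_apply, smul_eq_mul] at *
  rw [h1, h2]
  ring

/-- Along any line through (aη, bη) the energy is a quartic polynomial in t. The quadratic forms
contribute only at order t² since η lies in their kernel, and the two algebraic equations remove the
linear term of the quartic part. -/
theorem isCriticalPoint_smul (hη : IsGroundState ε η) (hε : 0 < ε) {γ a b : ℝ}
    (ha : a * (a ^ 2 + γ * b ^ 2 - 1) = 0) (hb : b * (γ * a ^ 2 + b ^ 2 - 1) = 0) :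
    IsCriticalPoint ε γ (a • η, b • η) := by
  refine ⟨hη.smul_mem_energySpace a b, fun V hV => ?_⟩
  obtain ⟨f, g⟩ := V
  obtain ⟨hf, hg⟩ : MemScalarEnergySpace f ∧ MemScalarEnergySpace g := hV
  have hh := hη.mem
  have iffff := hf.integrable_mul_mul hf hf hf
  have iffgg := hf.integrable_mul_mul hf hg hg
  have igggg := hg.integrable_mul_mul hg hg hg
  have ihhff := hh.integrable_mul_mul hh hf hf
  have ihhfg := hh.integrable_mul_mul hh hf hg
  have ihhgg := hh.integrable_mul_mul hh hg hg
  have ihfff := hh.integrable_mul_mul hf hf hf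
  have ihffg := hh.integrable_mul_mul hf hf hg
  have ihfgg := hh.integrable_mul_mul hf hg hg
  have ihggg := hh.integrable_mul_mul hg hg hg
  -- The functions c₂, c₃, c₄ are the coefficients of t², t³, t⁴ in the potential.
  obtain ⟨c₂, i₂, e₂⟩ : ∃ c : ℝ → ℝ, Integrable c ∧ ∀ x, c x = η x ^ 2 *
      ((3 * a ^ 2 + γ * b ^ 2 - 1) * f x ^ 2 + 4 * γ * a * b * (f x * g x)
        + (3 * b ^ 2 + γ * a ^ 2 - 1) * g x ^ 2) :=
    ⟨_, ((ihhff.const_mul (3 * a ^ 2 + γ * b ^ 2 - 1)).add (ihhfg.const_mul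
      (4 * γ * a * b))).add (ihhgg.const_mul (3 * b ^ 2 + γ * a ^ 2 - 1)), fun x => by
        simp only [Pi.add_apply]; ring⟩
  obtain ⟨c₃, i₃, e₃⟩ : ∃ c : ℝ → ℝ, Integrable c ∧ ∀ x, c x = η x *
      (2 * a * f x ^ 3 + 2 * γ * b * (f x ^ 2 * g x) + 2 * γ * a * (f x * g x ^ 2)
        + 2 * b * g x ^ 3) :=
    ⟨_, (((ihfff.const_mul (2 * a)).add (ihffg.const_mul (2 * γ * b))).add
      (ihfgg.const_mul (2 * γ * a))).add (ihggg.const_mul (2 * b)), fun x => by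
        simp only [Pi.add_apply]; ring⟩
  obtain ⟨c₄, i₄, e₄⟩ : ∃ c : ℝ → ℝ, Integrable c ∧ ∀ x, c x =
      (1 / 2) * f x ^ 4 + γ * (f x ^ 2 * g x ^ 2) + (1 / 2) * g x ^ 4 :=
    ⟨_, ((iffff.const_mul (1 / 2)).add (iffgg.const_mul γ)).add (igggg.const_mul (1 / 2)),
      fun x => by simp only [Pi.add_apply]; ring⟩
  have expand : ∀ t : ℝ, energy ε γ ((a • η, b • η) + t • (f, g)) =
      (1 / 2) * (reducedEnergy γ a b * ∫ x, η x ^ 4)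
      + (1 / 2) * (scalarForm ε η f + scalarForm ε η g + ∫ x, c₂ x) * t ^ 2
      + (1 / 2) * (∫ x, c₃ x) * t ^ 3 + (1 / 2) * (∫ x, c₄ x) * t ^ 4 := by
    intro t
    have hpot : (fun x => potential γ (η x) ((a • η + t • f) x) ((b • η + t • g) x)) =
        fun x => (reducedEnergy γ a b * η x ^ 4 + t ^ 2 * c₂ x)
          + (t ^ 3 * c₃ x + t ^ 4 * c₄ x) := by
      funext x
      rw [e₂, e₃, e₄]
      simp only [potential, reducedEnergy, Pi.add_apply, Pi.smul_apply, smul_eq_mul]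
      linear_combination (2 * t * f x * η x ^ 3) * ha + (2 * t * g x * η x ^ 3) * hb
    have i0 := hη.integrable_pow_four.const_mul (reducedEnergy γ a b)
    have s1 := integral_add (i0.add (i₂.const_mul (t ^ 2)))
      ((i₃.const_mul (t ^ 3)).add (i₄.const_mul (t ^ 4)))
    simp only [Pi.add_apply] at s1
    have e : (a • η, b • η) + t • (f, g) = (a • η + t • f, b • η + t • g) := rfl
    rw [e, hη.energy_eq γ ((hh.const_smul a).add (hf.const_smul t))
      ((hh.const_smul b).add (hg.const_smul t)), hη.scalarForm_smul_add hε hf,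
      hη.scalarForm_smul_add hε hg, hpot, s1, integral_add i0 (i₂.const_mul (t ^ 2)),
      integral_add (i₃.const_mul (t ^ 3)) (i₄.const_mul (t ^ 4)), integral_const_mul,
      integral_const_mul, integral_const_mul, integral_const_mul]
    ring
  rw [funext expand]
  have hd := ((((hasDerivAt_id (0 : ℝ)).pow 2).const_mul
    ((1 / 2) * (scalarForm ε η f + scalarForm ε η g + ∫ x, c₂ x))).const_add
      ((1 / 2) * (reducedEnergy γ a b * ∫ x, η x ^ 4))).add
    (((hasDerivAt_id (0 : ℝ)).pow 3).const_mul ((1 / 2) * ∫ x, c₃ x)) |>.add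
    (((hasDerivAt_id (0 : ℝ)).pow 4).const_mul ((1 / 2) * ∫ x, c₄ x))
  exact hd.congr_deriv (by simp)

theorem exists_energyNorm_sub_lt (hη : IsGroundState ε η) (a b : ℝ) {δ : ℝ} (hδ : 0 < δ) :
    ∃ r > 0, ∀ a' b', (a' - a) ^ 2 + (b' - b) ^ 2 < r →
      energyNorm ((a' • η, b' • η) - (a • η, b • η)) < δ := by
  set I := ∫ x, (weakDeriv η x ^ 2 + (1 + x ^ 2) * η x ^ 2) with hI
  have hI0 : 0 ≤ I := integral_nonneg fun x => by simp only [Pi.zero_apply]; positivity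
  refine ⟨δ ^ 2 / (I + 1), by positivity, fun a' b' h => ?_⟩
  have e : (a' • η, b' • η) - (a • η, b • η) = ((a' - a) • η, (b' - b) • η) := by
    rw [Prod.mk_sub_mk, sub_smul, sub_smul]
  rw [e, hη.energyNorm_smul, Real.sqrt_lt' hδ]
  rw [lt_div_iff₀ (by positivity)] at h
  nlinarith [sq_nonneg (a' - a), sq_nonneg (b' - b)]

theorem isSaddlePoint_smul (hη : IsGroundState ε η) (hε : 0 < ε) {γ a b : ℝ}
    (ha : a * (a ^ 2 + γ * b ^ 2 - 1) = 0) (hb : b * (γ * a ^ 2 + b ^ 2 - 1) = 0)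
    (lower : ∀ r > 0, ∃ a' b', (a' - a) ^ 2 + (b' - b) ^ 2 < r ∧
      reducedEnergy γ a' b' < reducedEnergy γ a b)
    (upper : ∀ r > 0, ∃ a' b', (a' - a) ^ 2 + (b' - b) ^ 2 < r ∧
      reducedEnergy γ a b < reducedEnergy γ a' b') :
    IsSaddlePoint ε γ (a • η, b • η) := by
  refine ⟨hη.isCriticalPoint_smul hε ha hb, fun δ hδ => ?_⟩
  obtain ⟨r, hr, h⟩ := hη.exists_energyNorm_sub_lt a b hδ
  have hI := hη.integral_pow_four_pos
  obtain ⟨a₁, b₁, h1, h2⟩ := lower r hr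
  obtain ⟨a₂, b₂, h3, h4⟩ := upper r hr
  refine ⟨⟨_, hη.smul_mem_energySpace a₁ b₁, h _ _ h1, ?_⟩,
    ⟨_, hη.smul_mem_energySpace a₂ b₂, h _ _ h3, ?_⟩⟩
  · rw [hη.energy_smul hε, hη.energy_smul hε]
    linarith [mul_lt_mul_of_pos_right h2 hI]
  · rw [hη.energy_smul hε, hη.energy_smul hε]
    linarith [mul_lt_mul_of_pos_right h4 hI]

end IsGroundState

theorem uncoupledFst_eq (η : ℝ → ℝ) : uncoupledFst η = ((1 : ℝ) • η, (0 : ℝ) • η) := by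
  simp [uncoupledFst]

theorem uncoupledSnd_eq (η : ℝ → ℝ) : uncoupledSnd η = ((0 : ℝ) • η, (1 : ℝ) • η) := by
  simp [uncoupledSnd]

theorem symmetricState_eq (γ : ℝ) (η : ℝ → ℝ) :
    symmetricState γ η = ((√(1 + γ))⁻¹ • η, (√(1 + γ))⁻¹ • η) := rfl

theorem inv_sqrt_sq_mul {γ : ℝ} (hγ : 0 < γ) : (√(1 + γ))⁻¹ ^ 2 * (1 + γ) = 1 := by
  rw [inv_pow, Real.sq_sqrt (by linarith), inv_mul_cancel₀ (by linarith)]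

/-! ### Saddles of the two-variable polynomial -/

section Reduced

variable {γ r : ℝ}

theorem reducedEnergy_comm (γ a b : ℝ) : reducedEnergy γ a b = reducedEnergy γ b a := by
  simp only [reducedEnergy]; ring

theorem exists_reducedEnergy_lt_one_zero (hγ : γ < 1) (hr : 0 < r) :
    ∃ a b, (a - 1) ^ 2 + (b - 0) ^ 2 < r ∧ reducedEnergy γ a b < reducedEnergy γ 1 0 := by
  -- Here t plays the role of b²: passing from (1, 0) to (1, √t) changes the value by t²/2 − (1 −
  -- γ)t.
  have ht : 0 < min (r / 2) (1 - γ) := lt_min (by linarith) (by linarith)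
  set t := min (r / 2) (1 - γ)
  have h1 : t ≤ r / 2 := min_le_left _ _
  have h2 : t ≤ 1 - γ := min_le_right _ _
  have h3 := Real.sq_sqrt ht.le
  refine ⟨1, √t, by rw [sub_zero, h3]; linarith, ?_⟩
  simp only [reducedEnergy, h3]
  nlinarith

theorem exists_lt_reducedEnergy_one_zero (γ : ℝ) (hr : 0 < r) :
    ∃ a b, (a - 1) ^ 2 + (b - 0) ^ 2 < r ∧ reducedEnergy γ 1 0 < reducedEnergy γ a b := by
  have ht : 0 < r / 2 := by linarith
  have h3 := Real.sq_sqrt ht.le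
  have h4 := Real.sqrt_pos.2 ht
  refine ⟨1 + √(r / 2), 0, by rw [add_sub_cancel_left, h3]; linarith, ?_⟩
  simp only [reducedEnergy]
  have h5 : 0 < ((1 + √(r / 2)) ^ 2 - 1) ^ 2 := by
    have : 0 < (1 + √(r / 2)) ^ 2 - 1 := by nlinarith
    positivity
  nlinarith

variable {c : ℝ}

/-- On the circle a² + b² = 2c² only (γ − 1)a²b² varies. Squares c² ± t lower a²b² from c⁴ to c⁴ −
t². -/
theorem exists_reducedEnergy_lt_diag (hγ : 1 < γ) (hc : 0 < c) (hr : 0 < r) :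
    ∃ a b, (a - c) ^ 2 + (b - c) ^ 2 < r ∧ reducedEnergy γ a b < reducedEnergy γ c c := by
  have ht : 0 < min (r / 4) (c ^ 2) := lt_min (by linarith) (by positivity)
  set t := min (r / 4) (c ^ 2)
  have h1 : t ≤ r / 4 := min_le_left _ _
  have h2 : t ≤ c ^ 2 := min_le_right _ _
  have h3 := Real.sq_sqrt (by positivity : 0 ≤ c ^ 2 + t)
  have h4 := Real.sq_sqrt (by linarith : 0 ≤ c ^ 2 - t)
  have h5 : c ≤ √(c ^ 2 + t) := Real.le_sqrt_of_sq_le (by linarith)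
  have h6 : √(c ^ 2 - t) ≤ c := Real.sqrt_le_iff.2 ⟨hc.le, by linarith⟩
  have h7 := Real.sqrt_nonneg (c ^ 2 - t)
  refine ⟨√(c ^ 2 + t), √(c ^ 2 - t), by nlinarith, ?_⟩
  simp only [reducedEnergy, h3, h4]
  nlinarith [mul_pos (sub_pos.2 hγ) (pow_pos ht 2)]

/-- Along the diagonal the value is (1 + γ)d⁴ − 2d², strictly minimal among d > 0 at d = c. -/
theorem exists_lt_reducedEnergy_diag (hc : 0 < c) (hc1 : c ^ 2 * (1 + γ) = 1) (hr : 0 < r) :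
    ∃ a b, (a - c) ^ 2 + (b - c) ^ 2 < r ∧ reducedEnergy γ c c < reducedEnergy γ a b := by
  have ht : 0 < r / 4 := by linarith
  have h3 := Real.sq_sqrt ht.le
  have h4 := Real.sqrt_pos.2 ht
  refine ⟨c + √(r / 4), c + √(r / 4), by rw [add_sub_cancel_left, h3]; linarith, ?_⟩
  set d := c + √(r / 4)
  have hd : c < d := by simp only [d]; linarith
  have h5 : 0 < (d ^ 2 - c ^ 2) ^ 2 := by
    have : 0 < d ^ 2 - c ^ 2 := by nlinarith
    positivity
  have hγ : 0 < 1 + γ := by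
    by_contra! h
    nlinarith [sq_nonneg c]
  have e : reducedEnergy γ d d - reducedEnergy γ c c = (1 + γ) * (d ^ 2 - c ^ 2) ^ 2 := by
    simp only [reducedEnergy]
    linear_combination (2 * (d ^ 2 - c ^ 2)) * hc1
  nlinarith [mul_pos hγ h5]

end Reduced

/-! ### Uniqueness of the positive solution for weak coupling -/

theorem controlledDecay_of_system {ε γ : ℝ} (hε : 0 < ε) (hγ : 0 < γ)
    {u u' u'' v v' v'' : ℝ → ℝ}
    (hu : ∀ x, HasDerivAt u (u' x) x) (hu' : ∀ x, HasDerivAt u' (u'' x) x)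
    (hv : ∀ x, HasDerivAt v (v' x) x) (hv' : ∀ x, HasDerivAt v' (v'' x) x)
    (pu : ∀ x, 0 < u x) (pv : ∀ x, 0 < v x)
    (equ : ∀ x, ε ^ 2 * u'' x = (x ^ 2 - 1 + u x ^ 2 + γ * v x ^ 2) * u x)
    (eqv : ∀ x, ε ^ 2 * v'' x = (x ^ 2 - 1 + v x ^ 2 + γ * u x ^ 2) * v x) :
    ControlledDecay u u' := by
  refine controlledDecay_of_eqn (h := fun x => γ * v x ^ 2) (M := γ * v 1 ^ 2) hε hu hu' pu
    (fun x => by positivity) (fun x hx => ?_) equ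
  have h1 := apply_le_apply_one_of_eqn (h := fun x => γ * u x ^ 2) hε hv hv' pv
    (fun x => by positivity) eqv x hx
  exact mul_le_mul_of_nonneg_left (pow_le_pow_left₀ (pv x).le h1 2) hγ.le

/-- Uniqueness for the coupled system with weak coupling, by the Brezis-Oswald identity. -/
theorem eq_of_system {ε γ : ℝ} (hε : 0 < ε) (hγ : 0 < γ) (hγ1 : γ < 1)
    {u u' u'' v v' v'' w w' w'' : ℝ → ℝ}
    (hu : ∀ x, HasDerivAt u (u' x) x) (hu' : ∀ x, HasDerivAt u' (u'' x) x)
    (hv : ∀ x, HasDerivAt v (v' x) x) (hv' : ∀ x, HasDerivAt v' (v'' x) x)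
    (hw : ∀ x, HasDerivAt w (w' x) x) (hw' : ∀ x, HasDerivAt w' (w'' x) x)
    (pu : ∀ x, 0 < u x) (pv : ∀ x, 0 < v x) (pw : ∀ x, 0 < w x)
    (equ : ∀ x, ε ^ 2 * u'' x = (x ^ 2 - 1 + u x ^ 2 + γ * v x ^ 2) * u x)
    (eqv : ∀ x, ε ^ 2 * v'' x = (x ^ 2 - 1 + v x ^ 2 + γ * u x ^ 2) * v x)
    (eqw : ∀ x, ε ^ 2 * w'' x = (x ^ 2 - 1 + w x ^ 2 + γ * w x ^ 2) * w x) :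
    u = w ∧ v = w := by
  set B : ℝ → ℝ := fun x => brezisOswald u u' w w' x + brezisOswald v v' w w' x with hB
  have top : Tendsto B atTop (𝓝 0) := by
    have du := controlledDecay_of_system hε hγ hu hu' hv hv' pu pv equ eqv
    have dv := controlledDecay_of_system hε hγ hv hv' hu hu' pv pu eqv equ
    have dw := controlledDecay_of_system hε hγ hw hw' hw hw' pw pw eqw eqw
    simpa using (tendsto_brezisOswald pu pw du dw).add (tendsto_brezisOswald pv pw dv dw)
  -- The system is invariant under x ↦ −x and the Brezis-Oswald term changes sign, so the limit at
  -- +∞ transfers.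
  have bot : Tendsto B atBot (𝓝 0) := by
    have nu := hasDerivAt_comp_neg hu
    have nu' := hasDerivAt_neg_comp_neg hu'
    have nv := hasDerivAt_comp_neg hv
    have nv' := hasDerivAt_neg_comp_neg hv'
    have nw := hasDerivAt_comp_neg hw
    have nw' := hasDerivAt_neg_comp_neg hw'
    have qu := fun x => pu (-x)
    have qv := fun x => pv (-x)
    have qw := fun x => pw (-x)
    have fu : ∀ x, ε ^ 2 * u'' (-x) =
        (x ^ 2 - 1 + u (-x) ^ 2 + γ * v (-x) ^ 2) * u (-x) := fun x => by
      rw [equ, neg_sq]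
    have fv : ∀ x, ε ^ 2 * v'' (-x) =
        (x ^ 2 - 1 + v (-x) ^ 2 + γ * u (-x) ^ 2) * v (-x) := fun x => by
      rw [eqv, neg_sq]
    have fw : ∀ x, ε ^ 2 * w'' (-x) =
        (x ^ 2 - 1 + w (-x) ^ 2 + γ * w (-x) ^ 2) * w (-x) := fun x => by
      rw [eqw, neg_sq]
    have du := controlledDecay_of_system hε hγ nu nu' nv nv' qu qv fu fv
    have dv := controlledDecay_of_system hε hγ nv nv' nu nu' qv qu fv fu
    have dw := controlledDecay_of_system hε hγ nw nw' nw nw' qw qw fw fw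
    have h := ((tendsto_brezisOswald qu qw du dw).add
      (tendsto_brezisOswald qv qw dv dw)).neg.comp tendsto_neg_atBot_atTop
    rw [add_zero, neg_zero] at h
    refine h.congr fun x => ?_
    simp only [Function.comp_apply, brezisOswald, neg_neg, hB]
    ring
  have der : ∀ x, HasDerivAt B
      (((w' x / w x - u' x / u x) ^ 2 * (w x ^ 2 + u x ^ 2)
        + (w' x / w x - v' x / v x) ^ 2 * (w x ^ 2 + v x ^ 2))
        + ((u x ^ 2 - w x ^ 2) ^ 2 + 2 * γ * (u x ^ 2 - w x ^ 2) * (v x ^ 2 - w x ^ 2)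
          + (v x ^ 2 - w x ^ 2) ^ 2) / ε ^ 2) x := fun x => by
    have sol : ∀ {y z V : ℝ}, 0 < z → ε ^ 2 * y = V * z → y / z = V / ε ^ 2 := by
      intro y z V hz h
      rw [div_eq_div_iff hz.ne' (by positivity)]
      linarith
    refine ((hasDerivAt_brezisOswald (hu x) (hu' x) (hw x) (hw' x) (pu x) (pw x)).add
      (hasDerivAt_brezisOswald (hv x) (hv' x) (hw x) (hw' x) (pv x) (pw x))).congr_deriv ?_
    rw [sol (pu x) (equ x), sol (pv x) (eqv x), sol (pw x) (eqw x)]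
    ring
  have quad : ∀ s t : ℝ, s ^ 2 + 2 * γ * s * t + t ^ 2 =
      (1 - γ) * (s ^ 2 + t ^ 2) + γ * (s + t) ^ 2 := fun s t => by ring
  have p1 : ∀ x, 0 ≤ (w' x / w x - u' x / u x) ^ 2 * (w x ^ 2 + u x ^ 2)
      + (w' x / w x - v' x / v x) ^ 2 * (w x ^ 2 + v x ^ 2) := fun x => by positivity
  have h1γ : 0 < 1 - γ := sub_pos.2 hγ1
  have mono : Monotone B := by
    refine monotone_of_deriv_nonneg (fun x => (der x).differentiableAt) fun x => ?_
    rw [(der x).deriv, quad]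
    exact add_nonneg (p1 x) (by positivity)
  have zero : B = fun _ => 0 := funext fun x =>
    le_antisymm (mono.ge_of_tendsto top x) (mono.le_of_tendsto bot x)
  have main : ∀ x, u x = w x ∧ v x = w x := fun x => by
    have h0 : HasDerivAt B 0 x := zero ▸ hasDerivAt_const x (0 : ℝ)
    have h1 := (der x).unique h0
    rw [quad] at h1
    have h2 := (add_eq_zero_iff_of_nonneg (p1 x) (by positivity)).1 h1
    have h3 := (div_eq_zero_iff.1 h2.2).resolve_right (by positivity)
    have h4 := (add_eq_zero_iff_of_nonneg (by positivity) (by positivity)).1 h3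
    have h5 := (mul_eq_zero.1 h4.1).resolve_left h1γ.ne'
    have h6 := (add_eq_zero_iff_of_nonneg (sq_nonneg _) (sq_nonneg _)).1 h5
    have fin : ∀ {y z : ℝ}, 0 < y → 0 < z → (y ^ 2 - z ^ 2) ^ 2 = 0 → y = z := by
      intro y z hy hz h
      have := sub_eq_zero.1 (pow_eq_zero_iff two_ne_zero |>.1 h)
      exact (pow_left_inj₀ hy.le hz.le two_ne_zero).1 this
    exact ⟨fin (pu x) (pw x) h6.1, fin (pv x) (pw x) h6.2⟩
  exact ⟨funext fun x => (main x).1, funext fun x => (main x).2⟩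

/-! ### Minimizers, saddles and uniqueness for the coupled system -/

namespace IsGroundState

variable {ε : ℝ} {η : ℝ → ℝ}

theorem isPositiveSolution_iff (hη : IsGroundState ε η) (hε : 0 < ε) {γ : ℝ} (hγ : 0 < γ)
    (hγ1 : γ < 1) (Ψ : (ℝ → ℝ) × (ℝ → ℝ)) :
    IsPositiveSolution ε γ Ψ ↔ Ψ = symmetricState γ η := by
  have hc := inv_sqrt_sq_mul hγ
  have hc0 : 0 < (√(1 + γ))⁻¹ := inv_pos.2 (Real.sqrt_pos.2 (by linarith))
  have d1 := hasDerivAt_of_contDiff_two hη.contDiff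
  have d2 := hasDerivAt_deriv_of_contDiff_two hη.contDiff
  unfold symmetricState
  set c := (√(1 + γ))⁻¹
  have w1 : ∀ x, HasDerivAt (fun x => c * η x) (c * deriv η x) x := fun x => (d1 x).const_mul c
  have w2 : ∀ x, HasDerivAt (fun x => c * deriv η x) (c * deriv (deriv η) x) x :=
    fun x => (d2 x).const_mul c
  have wpos : ∀ x, 0 < c * η x := fun x => mul_pos hc0 (hη.pos x)
  have weq : ∀ x, ε ^ 2 * (c * deriv (deriv η) x) =
      (x ^ 2 - 1 + (c * η x) ^ 2 + γ * (c * η x) ^ 2) * (c * η x) := fun x => by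
    linear_combination c * hη.eqn x - c * η x ^ 3 * hc
  constructor
  · intro h
    obtain ⟨e1, e2⟩ := eq_of_system hε hγ hγ1 (hasDerivAt_of_contDiff_two h.contDiff_fst)
      (hasDerivAt_deriv_of_contDiff_two h.contDiff_fst) (hasDerivAt_of_contDiff_two h.contDiff_snd)
      (hasDerivAt_deriv_of_contDiff_two h.contDiff_snd) w1 w2 h.pos_fst h.pos_snd wpos
      (fun x => by linarith [h.eqn_fst x]) (fun x => by linarith [h.eqn_snd x]) weq
    exact Prod.ext e1 e2
  · rintro rfl
    have e : deriv (deriv fun x => c * η x) = fun x => c * deriv (deriv η) x := by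
      rw [funext fun x => (w1 x).deriv]
      exact funext fun x => (w2 x).deriv
    refine ⟨contDiff_const.mul hη.contDiff, contDiff_const.mul hη.contDiff, wpos, wpos,
      fun x => ?_, fun x => ?_⟩ <;>
    · simp only [e]
      linarith [weq x]

theorem isGlobalMinimizer_symmetricState (hη : IsGroundState ε η) (hε : 0 < ε) {γ : ℝ}
    (hγ : 0 < γ) (hγ1 : γ < 1) : IsGlobalMinimizer ε γ (symmetricState γ η) := by
  have hc := inv_sqrt_sq_mul hγ
  rw [symmetricState_eq]
  set c := (√(1 + γ))⁻¹
  refine ⟨hη.smul_mem_energySpace c c, ?_⟩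
  rintro ⟨f, g⟩ ⟨hf, hg⟩
  rw [hη.energy_smul hε, hη.energy_eq γ hf hg, ← integral_const_mul]
  have h1 : ∫ x, reducedEnergy γ c c * η x ^ 4 ≤ ∫ x, potential γ (η x) (f x) (g x) := by
    refine integral_mono (hη.integrable_pow_four.const_mul _)
      (hη.integrable_potential γ hf hg) fun x => ?_
    -- Squares in the sum and difference of f² and g²; both coefficients are nonnegative exactly
    -- because −1 ≤ γ ≤ 1.
    have e : potential γ (η x) (f x) (g x) - reducedEnergy γ c c * η x ^ 4 =
        (1 + γ) / 4 * (f x ^ 2 + g x ^ 2 - 2 * c ^ 2 * η x ^ 2) ^ 2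
          + (1 - γ) / 4 * (f x ^ 2 - g x ^ 2) ^ 2 := by
      simp only [potential, reducedEnergy]
      linear_combination ((f x ^ 2 + g x ^ 2) * η x ^ 2 - 2 * c ^ 2 * η x ^ 4) * hc
    have h2 : 0 ≤ (1 + γ) / 4 := by linarith
    have h3 : 0 ≤ (1 - γ) / 4 := by linarith
    have h4 : 0 ≤ potential γ (η x) (f x) (g x) - reducedEnergy γ c c * η x ^ 4 := by
      rw [e]; positivity
    exact sub_nonneg.1 h4
  linarith [hη.scalarForm_nonneg hε hf, hη.scalarForm_nonneg hε hg]

theorem isSaddlePoint_uncoupledFst (hη : IsGroundState ε η) (hε : 0 < ε) {γ : ℝ} (hγ1 : γ < 1) :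
    IsSaddlePoint ε γ (uncoupledFst η) := by
  rw [uncoupledFst_eq]
  exact hη.isSaddlePoint_smul hε (by ring) (by ring)
    (fun r hr => exists_reducedEnergy_lt_one_zero hγ1 hr)
    (fun r hr => exists_lt_reducedEnergy_one_zero γ hr)

theorem isSaddlePoint_uncoupledSnd (hη : IsGroundState ε η) (hε : 0 < ε) {γ : ℝ} (hγ1 : γ < 1) :
    IsSaddlePoint ε γ (uncoupledSnd η) := by
  rw [uncoupledSnd_eq]
  refine hη.isSaddlePoint_smul hε (by ring) (by ring) (fun r hr => ?_) fun r hr => ?_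
  · obtain ⟨a, b, h1, h2⟩ := exists_reducedEnergy_lt_one_zero hγ1 hr
    exact ⟨b, a, by linarith, by rwa [reducedEnergy_comm γ b, reducedEnergy_comm γ 0]⟩
  · obtain ⟨a, b, h1, h2⟩ := exists_lt_reducedEnergy_one_zero γ hr
    exact ⟨b, a, by linarith, by rwa [reducedEnergy_comm γ b, reducedEnergy_comm γ 0]⟩

theorem isSaddlePoint_symmetricState (hη : IsGroundState ε η) (hε : 0 < ε) {γ : ℝ}
    (hγ1 : 1 < γ) : IsSaddlePoint ε γ (symmetricState γ η) := by
  have hc := inv_sqrt_sq_mul (one_pos.trans hγ1)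
  have hc0 : 0 < (√(1 + γ))⁻¹ := inv_pos.2 (Real.sqrt_pos.2 (by linarith))
  rw [symmetricState_eq]
  exact hη.isSaddlePoint_smul hε (by linear_combination (√(1 + γ))⁻¹ * hc)
    (by linear_combination (√(1 + γ))⁻¹ * hc)
    (fun r hr => exists_reducedEnergy_lt_diag hγ1 hc0 hr)
    (fun r hr => exists_lt_reducedEnergy_diag hc0 hc hr)

end IsGroundState

theorem energy_congr {ε γ : ℝ} {Ψ Υ : (ℝ → ℝ) × (ℝ → ℝ)} (hΨ : Ψ ∈ energySpace)
    (h : AEEq Ψ Υ) : energy ε γ Ψ = energy ε γ Υ := by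
  rw [energy, energy]
  congr 1
  refine integral_congr_ae ?_
  filter_upwards [h.1, h.2, weakDeriv_congr h.1 ⟨_, hΨ.1.hasWeakDeriv⟩,
    weakDeriv_congr h.2 ⟨_, hΨ.2.hasWeakDeriv⟩] with x h1 h2 h3 h4
  rw [h1, h2, h3, h4]

theorem AEEq.symm {Ψ Υ : (ℝ → ℝ) × (ℝ → ℝ)} (h : AEEq Ψ Υ) : AEEq Υ Ψ :=
  ⟨h.1.symm, h.2.symm⟩

theorem AEEq.mem_energySpace {Ψ Υ : (ℝ → ℝ) × (ℝ → ℝ)} (h : AEEq Ψ Υ) (hΨ : Ψ ∈ energySpace) :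
    Υ ∈ energySpace :=
  ⟨hΨ.1.congr h.1, hΨ.2.congr h.2⟩

namespace IsGroundState

variable {ε : ℝ} {η : ℝ → ℝ}

/-- For strong coupling the energy exceeds that of an uncoupled state by at least the quadratic
form of the ground state. -/
theorem le_energy (hη : IsGroundState ε η) {γ : ℝ} (hγ1 : 1 < γ)
    {f g : ℝ → ℝ} (hf : MemScalarEnergySpace f) (hg : MemScalarEnergySpace g) :
    (1 / 2) * (scalarForm ε η f + scalarForm ε η g + -(1 / 2) * ∫ x, η x ^ 4)
      ≤ energy ε γ (f, g) := by
  rw [hη.energy_eq γ hf hg, ← integral_const_mul]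
  have h1 : ∫ x, -(1 / 2) * η x ^ 4 ≤ ∫ x, potential γ (η x) (f x) (g x) := by
    refine integral_mono (hη.integrable_pow_four.const_mul _)
      (hη.integrable_potential γ hf hg) fun x => ?_
    have e : potential γ (η x) (f x) (g x) - -(1 / 2) * η x ^ 4 =
        1 / 2 * (f x ^ 2 + g x ^ 2 - η x ^ 2) ^ 2 + (γ - 1) * (f x ^ 2 * g x ^ 2) := by
      simp only [potential]
      ring
    have h3 : 0 ≤ γ - 1 := by linarith
    have h4 : 0 ≤ potential γ (η x) (f x) (g x) - -(1 / 2) * η x ^ 4 := by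
      rw [e]; positivity
    exact sub_nonneg.1 h4
  linarith

theorem isGlobalMinimizer_iff (hη : IsGroundState ε η) (hε : 0 < ε) {γ : ℝ} (hγ1 : 1 < γ)
    (Ψ : (ℝ → ℝ) × (ℝ → ℝ)) :
    IsGlobalMinimizer ε γ Ψ ↔
      AEEq Ψ (uncoupledFst η) ∨ AEEq Ψ (-uncoupledFst η) ∨
      AEEq Ψ (uncoupledSnd η) ∨ AEEq Ψ (-uncoupledSnd η) := by
  have hI := hη.integral_pow_four_pos
  have n1 : -uncoupledFst η = ((-1 : ℝ) • η, (0 : ℝ) • η) := by simp [uncoupledFst]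
  have n2 : -uncoupledSnd η = ((0 : ℝ) • η, (-1 : ℝ) • η) := by simp [uncoupledSnd]
  rw [n1, n2, uncoupledFst_eq, uncoupledSnd_eq]
  constructor
  · rintro ⟨hΨ, hmin⟩
    obtain ⟨f, g⟩ := Ψ
    obtain ⟨hf, hg⟩ : MemScalarEnergySpace f ∧ MemScalarEnergySpace g := hΨ
    have h1 := hmin _ (hη.smul_mem_energySpace 1 0)
    rw [hη.energy_smul hε] at h1
    have e0 : reducedEnergy γ 1 0 = -(1 / 2) := by simp only [reducedEnergy]; norm_num
    rw [e0] at h1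
    have h2 := hη.le_energy hγ1 hf hg
    have h3 := hη.scalarForm_nonneg hε hf
    have h4 := hη.scalarForm_nonneg hε hg
    -- Comparison with (η, 0) leaves no room for Q(f) or Q(g), so both vanish.
    obtain ⟨a, ha⟩ := hη.exists_eq_smul_of_scalarForm_eq_zero hε hf (by linarith)
    obtain ⟨b, hb⟩ := hη.exists_eq_smul_of_scalarForm_eq_zero hε hg (by linarith)
    have hab : AEEq (f, g) (a • η, b • η) := ⟨ha, hb⟩
    rw [energy_congr ⟨hf, hg⟩ hab, hη.energy_smul hε] at h1
    have h5 : reducedEnergy γ a b ≤ -(1 / 2) :=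
      le_of_mul_le_mul_right (by linarith) hI
    have h6 : 1 / 2 * (a ^ 2 + b ^ 2 - 1) ^ 2 + (γ - 1) * (a ^ 2 * b ^ 2) ≤ 0 := by
      simp only [reducedEnergy] at h5
      linarith
    have hγ : 0 < γ - 1 := sub_pos.2 hγ1
    have q1 : 0 ≤ (a ^ 2 + b ^ 2 - 1) ^ 2 := sq_nonneg _
    have q2 : 0 ≤ (γ - 1) * (a ^ 2 * b ^ 2) := by positivity
    have h7 : a ^ 2 + b ^ 2 - 1 = 0 := pow_eq_zero_iff two_ne_zero |>.1 (by linarith)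
    have h8 : a ^ 2 * b ^ 2 = 0 :=
      (mul_eq_zero.1 (by linarith : (γ - 1) * (a ^ 2 * b ^ 2) = 0)).resolve_left hγ.ne'
    rcases mul_eq_zero.1 h8 with h | h
    · obtain rfl := pow_eq_zero_iff two_ne_zero |>.1 h
      rcases sq_eq_one_iff.1 (by linarith : b ^ 2 = 1) with rfl | rfl
      · exact Or.inr (Or.inr (Or.inl hab))
      · exact Or.inr (Or.inr (Or.inr hab))
    · obtain rfl := pow_eq_zero_iff two_ne_zero |>.1 h
      rcases sq_eq_one_iff.1 (by linarith : a ^ 2 = 1) with rfl | rfl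
      · exact Or.inl hab
      · exact Or.inr (Or.inl hab)
  · have key : ∀ a b : ℝ, reducedEnergy γ a b = -(1 / 2) → AEEq Ψ (a • η, b • η) →
        IsGlobalMinimizer ε γ Ψ := by
      intro a b hab h
      have hm := hη.smul_mem_energySpace a b
      refine ⟨h.symm.mem_energySpace hm, ?_⟩
      rintro ⟨f, g⟩ ⟨hf, hg⟩
      rw [← energy_congr hm h.symm, hη.energy_smul hε, hab]
      linarith [hη.le_energy hγ1 hf hg, hη.scalarForm_nonneg hε hf, hη.scalarForm_nonneg hε hg]
    rintro (h | h | h | h)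
    all_goals exact key _ _ (by simp only [reducedEnergy]; norm_num) h

end IsGroundState

end GrossPitaevskii

open GrossPitaevskii in
theorem theorem1p2 (ε : ℝ) (hε : 0 < ε) (η : ℝ → ℝ) (hη : IsGroundState ε η)
    (γ : ℝ) (hγ : 0 < γ) :
    (γ < 1 →
      IsGlobalMinimizer ε γ (symmetricState γ η) ∧
      (∀ Ψ : (ℝ → ℝ) × (ℝ → ℝ), IsPositiveSolution ε γ Ψ ↔ Ψ = symmetricState γ η) ∧
      IsSaddlePoint ε γ (uncoupledFst η) ∧
      IsSaddlePoint ε γ (uncoupledSnd η)) ∧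
    (1 < γ →
      IsSaddlePoint ε γ (symmetricState γ η) ∧
      (∀ Ψ : (ℝ → ℝ) × (ℝ → ℝ), IsGlobalMinimizer ε γ Ψ ↔
        AEEq Ψ (uncoupledFst η) ∨ AEEq Ψ (-uncoupledFst η) ∨
        AEEq Ψ (uncoupledSnd η) ∨ AEEq Ψ (-uncoupledSnd η))) :=
  ⟨fun h => ⟨hη.isGlobalMinimizer_symmetricState hε hγ h, hη.isPositiveSolution_iff hε hγ h,
    hη.isSaddlePoint_uncoupledFst hε h, hη.isSaddlePoint_uncoupledSnd hε h⟩,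
  fun h => ⟨hη.isSaddlePoint_symmetricState hε h, hη.isGlobalMinimizer_iff hε h⟩⟩
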